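/- Let $k$ be an algebraically closed field of characteristic zero, let $T=(k^\times)^n$ be an algebraic torus with character group $\mathfrak{X}(T)\cong\mathbb{Z}^n$, and let $\mathbb{X}$ be an irreducible affine $T$-variety over $k$ (reduced, of finite type). For a character $\chi$ let $k[\mathbb{X}]_\chi$ be the space of $T$-semiinvariant regular functions of weight $\chi$ on $\mathbb{X}$, let $\Sigma_{\mathbb{X}}=\{\chi\in\mathfrak{X}(T) : k[\mathbb{X}]_\chi\neq 0\}$, and let $\widehat{\Sigma}_{\mathbb{X}}=\{\chi\in\mathfrak{X}(T) : m\chi\in\Sigma_{\mathbb{X}}\text{ for some integer } m>0\}$. A *family of affine stable toric $T$-varieties over $\mathbb{X}$ with base $S$*, where $S$ is a $k$-scheme, is a $T$-scheme $X$ over $k$ with morphisms of $k$-schemes $p_S:X\to S$ and $p_{\mathbb{X}}:X\to\mathbb{X}$ such that (i) $p_{\mathbb{X}}$ is $T$-equivariant; (ii) $p_S$ is affine, $T$-invariant and of finite type, and for every $\chi\in\mathfrak{X}(T)$ the sheaf of $\mathcal{O}_S$-modules $((p_S)_*\mathcal{O}_X)_\chi$ of semiinvariants of weight $\chi$ is locally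 free of rank $1$ if $\chi\in\widehat{\Sigma}_{\mathbb{X}}$ and of rank $0$ otherwise; (iii) all geometric fibers of $p_S$ are reduced; (iv) the morphism $(p_S,p_{\mathbb{X}}):X\to S\times\mathbb{X}$ is finite. Put $\mathcal{F}=(p_S)_*\mathcal{O}_X$ and $\mathcal{F}_\chi=((p_S)_*\mathcal{O}_X)_\chi$, and let $\varphi_\chi:\mathcal{O}_S\otimes_k k[\mathbb{X}]_\chi\to\mathcal{F}_\chi$ be the $\mathcal{O}_S$-linear map given by pullback of functions along $p_{\mathbb{X}}$. Then the following hold. (1) There is a finite subset $A\subset\widehat{\Sigma}_{\mathbb{X}}$ such that, for every $S$ and every family $p_S:X\to S$ of affine stable toric $T$-varieties over $\mathbb{X}$, the sheaf of $\mathcal{O}_S$-algebras $\mathcal{F}$ is generated by its subsheaves $\mathcal{F}_\chi$, $\chi\in A$. (2) There is an integer $N>0$, depending only on the $T$-variety $\mathbb{X}$, such that, for every $S$, every family $p_S:X\to S$ of affine stable toric $T$-varieties over $\mathbb{X}$ and every $\chi\in\widehat{\Sigma}_{\mathbb{X}}$, the map of sheaves $\varphi_{N\chi}:\mathcal{O}_S\otimes_k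 k[\mathbb{X}]_{N\chi}\to\mathcal{F}_{N\chi}$ is surjective. -/

import Mathlib

open CategoryTheory MonoidalCategory CartesianMonoidalCategory AlgebraicGeometry
open Limits (pullback)
open scoped MonObj TensorProduct

noncomputable section

namespace ToricFamilies

universe u

theorem le_preimage_top {X Y : Scheme.{u}} (f : X ⟶ Y) (V : X.Opens) : V ≤ f ⁻¹ᵁ ⊤ := le_top

/-! ### Semiinvariant functions -/

section Semiinvariants

variable {X Y X' Y' : Scheme.{u}}

/-- For two morphisms `a, b : Y ⟶ X` and a function `c` on `Y`, the function `f` on the open subset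
`V` of `X` satisfies `f (a y) = c y * f (b y)` for all `y` with `a y` and `b y` in `V` (as an
equation between functions on the open subscheme `a⁻¹ V ∩ b⁻¹ V`). -/
def IsSemiinvariant (a b : Y ⟶ X) (c : Γ(Y, ⊤)) (V : X.Opens) (f : Γ(X, V)) : Prop :=
  a.appLE V (a ⁻¹ᵁ V ⊓ b ⁻¹ᵁ V) inf_le_left f =
    Y.presheaf.map (homOfLE (le_top : a ⁻¹ᵁ V ⊓ b ⁻¹ᵁ V ≤ ⊤)).op c *
      b.appLE V (a ⁻¹ᵁ V ⊓ b ⁻¹ᵁ V) inf_le_right f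

variable {a b : Y ⟶ X} {c : Γ(Y, ⊤)} {V : X.Opens} {f g : Γ(X, V)}

theorem IsSemiinvariant.zero : IsSemiinvariant a b c V 0 := by
  simp [IsSemiinvariant]

theorem IsSemiinvariant.add (hf : IsSemiinvariant a b c V f) (hg : IsSemiinvariant a b c V g) :
    IsSemiinvariant a b c V (f + g) := by
  unfold IsSemiinvariant at *
  rw [map_add, map_add, hf, hg, mul_add]

theorem IsSemiinvariant.mul {S : Scheme.{u}} {p : X ⟶ S} (hp : a ≫ p = b ≫ p) {U : S.Opens}
    {f : Γ(X, V)} (hV : V ≤ p ⁻¹ᵁ U) (r : Γ(S, U)) (hf : IsSemiinvariant a b c V f) :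
    IsSemiinvariant a b c V (p.appLE U V hV r * f) := by
  unfold IsSemiinvariant at *
  have hr : a.appLE V (a ⁻¹ᵁ V ⊓ b ⁻¹ᵁ V) inf_le_left (p.appLE U V hV r) =
      b.appLE V (a ⁻¹ᵁ V ⊓ b ⁻¹ᵁ V) inf_le_right (p.appLE U V hV r) := by
    rw [← CommRingCat.comp_apply, ← CommRingCat.comp_apply, Scheme.Hom.appLE_comp_appLE,
      Scheme.Hom.appLE_comp_appLE]
    simp only [hp]
  rw [map_mul, map_mul, hf, hr]
  ring

theorem IsSemiinvariant.appLE {q : X' ⟶ X} {Q : Y' ⟶ Y} {a' b' : Y' ⟶ X'} (ha : a' ≫ q = Q ≫ a)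
    (hb : b' ≫ q = Q ≫ b) (hf : IsSemiinvariant a b c V f) {W : X'.Opens} (h : W ≤ q ⁻¹ᵁ V) :
    IsSemiinvariant a' b' (Q.appTop c) W (q.appLE V W h f) := by
  unfold IsSemiinvariant at *
  have hW : a' ⁻¹ᵁ W ⊓ b' ⁻¹ᵁ W ≤ Q ⁻¹ᵁ (a ⁻¹ᵁ V ⊓ b ⁻¹ᵁ V) := by
    rintro y ⟨hy₁, hy₂⟩
    have h₁ : (a' ≫ q) y ∈ V := h hy₁
    have h₂ : (b' ≫ q) y ∈ V := h hy₂
    rw [ha] at h₁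
    rw [hb] at h₂
    exact ⟨h₁, h₂⟩
  have key := congrArg (Q.appLE _ _ hW) hf
  rw [map_mul] at key
  simp only [← CommRingCat.comp_apply, Scheme.Hom.appLE_comp_appLE, Scheme.Hom.map_appLE] at key ⊢
  simp only [ha, hb]
  rw [key]
  rfl

end Semiinvariants

variable {k : Type u} [Field k] {n : ℕ}

/-! ### The torus -/

/-- The character group `𝔛(T)` of the torus `T = (kˣ)ⁿ`: the vector `χ` stands for the character
`(t₁, …, tₙ) ↦ t₁ ^ χ₁ ⋯ tₙ ^ χₙ`. -/
abbrev Character (n : ℕ) : Type := Fin n → ℤ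

variable (k n) in
/-- The algebraic torus `T = (kˣ)ⁿ` as a scheme over `k`: the spectrum of the algebra of Laurent
polynomials in `n` variables. Its group structure is Mathlib's one on the spectrum of a Hopf
algebra (the monomials, which are the characters, are group-like). -/
abbrev Torus : Over (Spec (.of k)) :=
  (Spec (.of (AddMonoidAlgebra k (Character n)))).asOver (Spec (.of k))

variable (k) in
/-- A character `χ`, as a regular function on `T`. -/
def Character.toFunction (χ : Character n) : Γ((Torus k n).left, ⊤) :=
  (Scheme.ΓSpecIso (.of (AddMonoidAlgebra k (Character n)))).inv (AddMonoidAlgebra.single χ 1)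

/-! ### Functions on schemes over `k`

`Over (Spec (.of k))` is the category of schemes over `k`; its tensor product is the product
over `k`, and `X.left` is the scheme underlying `X`. -/

/-- The structure morphism of a `k`-scheme. -/
abbrev structureMap (X : Over (Spec (.of k))) : X.left ⟶ Spec (.of k) := X.hom

/-- The structure of a `k`-algebra on the functions on an open subset of a `k`-scheme. -/
instance sectionsAlgebra (X : Over (Spec (.of k))) (V : X.left.Opens) : Algebra k Γ(X.left, V) :=
  ((Scheme.ΓSpecIso (.of k)).inv ≫ (structureMap X).appLE ⊤ V (le_preimage_top _ V)).hom.toAlgebra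

theorem algebraMap_sections (X : Over (Spec (.of k))) (V : X.left.Opens) (c : k) :
    algebraMap k Γ(X.left, V) c =
      (structureMap X).appLE ⊤ V (le_preimage_top _ V) ((Scheme.ΓSpecIso (.of k)).inv c) := rfl

theorem appLE_algebraMap {X Y : Over (Spec (.of k))} (f : X ⟶ Y) (V : Y.left.Opens)
    (W : X.left.Opens) (h : W ≤ f.left ⁻¹ᵁ V) (c : k) :
    f.left.appLE V W h (algebraMap k Γ(Y.left, V) c) = algebraMap k Γ(X.left, W) c := by
  have e : f.left ≫ structureMap Y = structureMap X := Over.w f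
  rw [algebraMap_sections, algebraMap_sections, ← CommRingCat.comp_apply,
    Scheme.Hom.appLE_comp_appLE]
  simp only [e]

/-! ### Weights -/

section Weights

variable (X : Over (Spec (.of k))) [ModObj (Torus k n) X]

variable (k n) in
/-- The action `T × X ⟶ X`, `(t, x) ↦ t • x`. -/
abbrev act : Torus k n ⊗ X ⟶ X := γ[Torus k n, X]

/-- The space `𝒪(V)_χ` of the `T`-semiinvariant functions of weight `χ` on an open subset `V` of a
`T`-scheme `X`: the functions `f` with `f (t • x) = χ (t) * f x`, as functions of `(t, x)`. -/
def weightSpace (χ : Character n) (V : X.left.Opens) : Submodule k Γ(X.left, V) where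
  carrier := {f | IsSemiinvariant (act k n X).left (snd (Torus k n) X).left
    ((fst (Torus k n) X).left.appTop (χ.toFunction k)) V f}
  zero_mem' := .zero
  add_mem' := .add
  smul_mem' c f hf := by
    rw [Algebra.smul_def, algebraMap_sections]
    refine IsSemiinvariant.mul ?_ _ _ hf
    exact (Over.w (act k n X)).trans (Over.w (snd (Torus k n) X)).symm

/-- The weight set `Σ_X` of an affine `T`-scheme `X`: the characters `χ` with `k[X]_χ ≠ 0`. -/
def weightSet : Set (Character n) := {χ | weightSpace X χ ⊤ ≠ ⊥}

/-- The saturation `{χ | m χ ∈ Σ_X for some m > 0}` of the weight set. -/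
def saturatedWeightSet : Set (Character n) := {χ | ∃ m : ℕ, 0 < m ∧ m • χ ∈ weightSet X}

end Weights

/-! ### Direct images -/

/-- The sections `(p_* 𝒪_X)(U)` over an open subset `U` of `S`, for `p : X ⟶ S`. -/
def DirectImage {X S : Over (Spec (.of k))} (p : X ⟶ S) (U : S.left.Opens) : Type u :=
  Γ(X.left, p.left ⁻¹ᵁ U)

namespace DirectImage

variable {X S : Over (Spec (.of k))} (p : X ⟶ S)

instance (U : S.left.Opens) : CommRing (DirectImage p U) :=
  inferInstanceAs (CommRing Γ(X.left, p.left ⁻¹ᵁ U))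

instance (U : S.left.Opens) : Algebra k (DirectImage p U) :=
  inferInstanceAs (Algebra k Γ(X.left, p.left ⁻¹ᵁ U))

instance (U : S.left.Opens) : Algebra Γ(S.left, U) (DirectImage p U) :=
  (p.left.appLE U (p.left ⁻¹ᵁ U) le_rfl).hom.toAlgebra

instance (U : S.left.Opens) : IsScalarTower k Γ(S.left, U) (DirectImage p U) :=
  IsScalarTower.of_algebraMap_eq fun c => (appLE_algebraMap p U (p.left ⁻¹ᵁ U) le_rfl c).symm

/-- The restriction maps of `p_* 𝒪_X`. -/
def res {U V : S.left.Opens} (h : V ≤ U) : DirectImage p U →+* DirectImage p V :=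
  (X.left.presheaf.map (homOfLE (p.left.preimage_mono h)).op).hom

end DirectImage

/-- A morphism `p` from a `T`-scheme is `T`-invariant if `p (t • x) = p x`. -/
def IsInvariant (n : ℕ) {X S : Over (Spec (.of k))} [ModObj (Torus k n) X] (p : X ⟶ S) : Prop :=
  act k n X ≫ p = snd (Torus k n) X ≫ p

/-- The sheaf of `𝒪_S`-modules `(p_* 𝒪_X)_χ`, for a `T`-invariant morphism `p : X ⟶ S`. -/
def weightSheaf {X S : Over (Spec (.of k))} [ModObj (Torus k n) X] {p : X ⟶ S}
    (hp : IsInvariant n p) (χ : Character n) (U : S.left.Opens) :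
    Submodule Γ(S.left, U) (DirectImage p U) where
  carrier := {f | f ∈ weightSpace X χ (p.left ⁻¹ᵁ U)}
  zero_mem' := .zero
  add_mem' := .add
  smul_mem' c _ hf := IsSemiinvariant.mul (congrArg (fun g => g.left) hp) le_rfl c hf

/-- The sheaf `(p_* 𝒪_X)_χ` is locally free of rank `r`: every point of `S` has a neighbourhood `U`
on which some sections `e₁, …, e_r` form a basis, that is, they define an isomorphism from
`𝒪_U ^ r` to the restriction of `(p_* 𝒪_X)_χ` to `U`. -/
def IsLocallyFreeOfRank {X S : Over (Spec (.of k))} [ModObj (Torus k n) X] {p : X ⟶ S}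
    (hp : IsInvariant n p) (χ : Character n) (r : ℕ) : Prop :=
  ∀ s : S.left, ∃ U : S.left.Opens, s ∈ U ∧ ∃ e : Fin r → weightSheaf hp χ U,
    ∀ (V : S.left.Opens) (hVU : V ≤ U),
      ∃ b : Module.Basis (Fin r) Γ(S.left, V) (weightSheaf hp χ V),
        ∀ i, (b i : DirectImage p V) = DirectImage.res p hVU (e i : DirectImage p U)

/-! ### Families -/

/-- `p : X ⟶ S` is a family of affine `T`-schemes with Hilbert function `h`. -/
structure IsAffineFamily {X S : Over (Spec (.of k))} [ModObj (Torus k n) X] (p : X ⟶ S)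
    (h : Character n → ℕ) : Prop where
  affine : IsAffineHom p.left
  /-- Affine morphisms are quasi-compact, so this says that `p` is of finite type. -/
  finiteType : LocallyOfFiniteType p.left
  invariant : IsInvariant n p
  locallyFree : ∀ χ : Character n, IsLocallyFreeOfRank invariant χ (h χ)

open Classical in
/-- The function on the characters with value `1` on the set `A` and `0` elsewhere. -/
def hilbertFunction (A : Set (Character n)) (χ : Character n) : ℕ := if χ ∈ A then 1 else 0

/-- The `T`-scheme `X` with the morphisms `p : X ⟶ S` and `q : X ⟶ 𝕏` is a family of affine stable
toric `T`-varieties over `𝕏` with base `S`. -/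
structure IsStableToricFamily (n : ℕ) {𝕏 X S : Over (Spec (.of k))} [ModObj (Torus k n) 𝕏]
    [ModObj (Torus k n) X] (p : X ⟶ S) (q : X ⟶ 𝕏) : Prop
    extends IsAffineFamily p (hilbertFunction (saturatedWeightSet (n := n) 𝕏)) where
  /-- `q (t • x) = t • q x` -/
  equivariant : IsModHom (Torus k n) q
  /-- All geometric fibers of `p` are reduced. -/
  reduced : ∀ (K : Type u) [Field K] [IsAlgClosed K] (s : Spec (.of K) ⟶ S.left),
    IsReduced (pullback p.left s)
  /-- The morphism `(p, q) : X ⟶ S × 𝕏` is finite. -/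
  finite : IsFinite (lift p q).left

/-- The sheaf of `𝒪_S`-algebras `p_* 𝒪_X` is generated by its subsheaves `(p_* 𝒪_X)_χ`, `χ ∈ A`:
locally on `S`, every section is a polynomial in sections of these subsheaves. -/
def IsGeneratedByWeights {X S : Over (Spec (.of k))} [ModObj (Torus k n) X] {p : X ⟶ S}
    (hp : IsInvariant n p) (A : Set (Character n)) : Prop :=
  ∀ (U : S.left.Opens) (f : DirectImage p U), ∀ s ∈ U, ∃ (V : S.left.Opens) (hVU : V ≤ U), s ∈ V ∧
    DirectImage.res p hVU f ∈
      Algebra.adjoin Γ(S.left, V) (⋃ χ ∈ A, (weightSheaf hp χ V : Set (DirectImage p V)))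

section Comparison

variable {𝕏 X S : Over (Spec (.of k))} [ModObj (Torus k n) 𝕏] [ModObj (Torus k n) X]
  {p : X ⟶ S} {q : X ⟶ 𝕏}

theorem appLE_mem_weightSpace (hq : IsModHom (Torus k n) q) {χ : Character n} {V : 𝕏.left.Opens}
    {f : Γ(𝕏.left, V)} (hf : f ∈ weightSpace 𝕏 χ V) {W : X.left.Opens} (h : W ≤ q.left ⁻¹ᵁ V) :
    q.left.appLE V W h f ∈ weightSpace X χ W := by
  have ha : act k n X ≫ q = (Torus k n ◁ q) ≫ act k n 𝕏 := hq.smul_hom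
  have hb : snd (Torus k n) X ≫ q = (Torus k n ◁ q) ≫ snd (Torus k n) 𝕏 := by simp
  have hc : fst (Torus k n) X = (Torus k n ◁ q) ≫ fst (Torus k n) 𝕏 := by simp
  have := IsSemiinvariant.appLE (congrArg (fun g => g.left) ha) (congrArg (fun g => g.left) hb) hf h
  change IsSemiinvariant _ _ _ _ _
  have hc' : (fst (Torus k n) X).left = (Torus k n ◁ q).left ≫ (fst (Torus k n) 𝕏).left :=
    congrArg (fun g => g.left) hc
  rw [hc', Scheme.Hom.comp_appTop]
  exact this

/-- The pullback `k[𝕏]_χ → (p_* 𝒪_X)_χ(U)` of functions along `q`. -/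
def pullbackWeight (hp : IsInvariant n p) (hq : IsModHom (Torus k n) q) (χ : Character n)
    (U : S.left.Opens) : weightSpace 𝕏 χ ⊤ →ₗ[k] weightSheaf hp χ U where
  toFun g := ⟨q.left.appLE ⊤ (p.left ⁻¹ᵁ U) (le_preimage_top _ _) g.1, appLE_mem_weightSpace hq g.2 _⟩
  map_add' g g' := Subtype.ext (map_add (q.left.appLE ⊤ (p.left ⁻¹ᵁ U) (le_preimage_top _ _)).hom g.1 g'.1)
  map_smul' c g := by
    refine Subtype.ext ?_
    change q.left.appLE ⊤ (p.left ⁻¹ᵁ U) (le_preimage_top _ _) (c • g.1) =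
      c • (q.left.appLE ⊤ (p.left ⁻¹ᵁ U) (le_preimage_top _ _) g.1)
    rw [Algebra.smul_def, map_mul, appLE_algebraMap, ← Algebra.smul_def]

/-- The map `φ_χ : 𝒪_S ⊗ k[𝕏]_χ → (p_* 𝒪_X)_χ` on sections over `U`. -/
def comparison (hp : IsInvariant n p) (hq : IsModHom (Torus k n) q) (χ : Character n)
    (U : S.left.Opens) :
    Γ(S.left, U) ⊗[k] weightSpace 𝕏 χ ⊤ →ₗ[Γ(S.left, U)] weightSheaf hp χ U :=
  (pullbackWeight hp hq χ U).liftBaseChange Γ(S.left, U)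

/-- The map `φ_χ : 𝒪_S ⊗ k[𝕏]_χ → (p_* 𝒪_X)_χ` of sheaves on `S` is surjective: every section of
`(p_* 𝒪_X)_χ` is locally in the image. -/
def IsComparisonSurjective (hp : IsInvariant n p) (hq : IsModHom (Torus k n) q)
    (χ : Character n) : Prop :=
  ∀ (U : S.left.Opens) (f : weightSheaf hp χ U), ∀ s ∈ U, ∃ (V : S.left.Opens) (hVU : V ≤ U),
    s ∈ V ∧ ∃ t : Γ(S.left, V) ⊗[k] weightSpace 𝕏 χ ⊤,
      (comparison hp hq χ V t : DirectImage p V) = DirectImage.res p hVU (f : DirectImage p U)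

end Comparison

end ToricFamilies
end

/-! Fix nonzero semiinvariant generators `f i` of `k[𝕏]`, of weights `w i`. Two facts control a
family near a point `s` of the base.

Non-vanishing is generation: `𝓕_χ` has rank at most one, so a section of it that is nonzero on the
geometric fiber over `s` has an invertible coordinate near `s` and generates `𝓕_χ` there
(`exists_generates_of_eval_ne_zero`). Conversely, a local basis is nonzero on the fiber
(`eval_basis_ne_zero`).

Some monomial survives: for `χ` in the saturated weight set let `x` be a local basis of `𝓕_χ`.
Finiteness over `S × 𝕏` gives a monic equation for `x` whose coefficients are polynomials in the `f
i` over `𝒪_S`. In its component of weight `m • χ`, the power `x ^ m` is nonzero on the reduced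
fiber, so a coefficient of weight `d • χ` with `d > 0` is nonzero there, hence so is a monomial `f ^
a` of that weight (`exists_monomial_of_eval_ne_zero`).

For (2), only finitely many pairs of a support and a bounded remainder occur, so one `N` serves all:
there is `f ^ b` of weight `N • χ` with support inside that of `a` (`exists_uniform_exponent`). It
divides a power of `f ^ a`, so it is nonzero on the fiber and generates `𝓕_{Nχ}` near `s`.

For (1), write `a = r + d • e` with all entries of `r` below `d`. Then `χ` is the weight of `f ^ e`
plus a character `χ'` of bounded size with `d • χ'` the weight of `f ^ r`. If `x` is a local basis
of `𝓕_χ'`, then `x ^ d` generates its weight sheaf, so `f ^ r = c x ^ d` and `f ^ a = c (f ^ e x) ^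
d`. Thus `f ^ e x` is nonzero on the fiber and generates `𝓕_χ` (`exists_generator`); the finitely
many bounded weights suffice. -/

noncomputable section

namespace ToricFamilies

universe u

/-! ### Pushouts of commutative rings -/

section Pushout

variable {R A B C : CommRingCat.{u}} {f : R ⟶ A} {g : R ⟶ B} {f' : A ⟶ C} {g' : B ⟶ C}

/-- A basis of `A` over `R` is a basis of the pushout of `A` and `B` over `B`. -/
theorem bijective_sum_of_isPushout (H : IsPushout f g f' g') {J : Type*}
    {b : J → A} (hb : Function.Bijective fun c : J →₀ R ↦ c.sum fun i r ↦ f r * b i) :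
    Function.Bijective fun c : J →₀ B ↦ c.sum fun i x ↦ f' (b i) * g' x := by
  let _ := f.hom.toAlgebra
  let _ := g.hom.toAlgebra
  let _ := f'.hom.toAlgebra
  let _ := g'.hom.toAlgebra
  let _ := (f ≫ f').hom.toAlgebra
  have : IsScalarTower R A C := .of_algebraMap_eq' rfl
  have : IsScalarTower R B C := .of_algebraMap_eq' congr(($H.w).hom)
  have hP : Algebra.IsPushout R B A C :=
    (CommRingCat.isPushout_iff_isPushout.mp H).symm
  let b₀ : Module.Basis J R A :=
    .ofRepr (LinearEquiv.ofBijective (Finsupp.linearCombination R b) hb).symm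
  have hb₀ (i : J) : b₀ i = b i := by
    rw [← Module.Basis.repr_symm_single_one]
    exact (Finsupp.linearCombination_single R 1 i).trans (one_smul _ _)
  let b' := hP.out.basis b₀
  have hb : (fun c : J →₀ B ↦ c.sum fun i x ↦ f' (b i) * g' x) = b'.repr.symm := by
    ext c
    rw [Module.Basis.repr_symm_apply, Finsupp.linearCombination_apply]
    refine Finsupp.sum_congr fun i _ ↦ ?_
    rw [IsBaseChange.basis_apply, hb₀, Algebra.smul_def, mul_comm]
    rfl
  rw [hb]
  exact b'.repr.symm.bijective

/-- A tensor product is additively spanned by products of elements of its factors. This describes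
the functions on `U × 𝕏` that occur as coefficients of integral equations. -/
theorem closure_range_of_isPushout (H : IsPushout f g f' g') :
    Subring.closure (Set.range f' ∪ Set.range g') = ⊤ := by
  let _ := f.hom.toAlgebra
  let _ := g.hom.toAlgebra
  let _ := f'.hom.toAlgebra
  let _ := g'.hom.toAlgebra
  let _ := (f ≫ f').hom.toAlgebra
  have : IsScalarTower R A C := .of_algebraMap_eq' rfl
  have : IsScalarTower R B C := .of_algebraMap_eq' congr(($H.w).hom)
  have hP : Algebra.IsPushout R B A C :=
    (CommRingCat.isPushout_iff_isPushout.mp H).symm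
  refine eq_top_iff.mpr fun c _ ↦ ?_
  induction c using hP.out.inductionOn with
  | zero => exact zero_mem _
  | tmul a => exact Subring.subset_closure (.inl ⟨a, rfl⟩)
  | smul s c hc =>
    rw [Algebra.smul_def]
    exact mul_mem (Subring.subset_closure (.inr ⟨s, rfl⟩)) (hc trivial)
  | add c d hc hd => exact add_mem (hc trivial) (hd trivial)

/-- An element of `B` on which some `R`-linear form has the value `1` is nonzero in every nontrivial
base change. -/
theorem ne_zero_of_isPushout (H : IsPushout f g f' g') [Nontrivial A] (l : B →+ R)
    (hl : ∀ r x, l (g r * x) = r * l x) {e : B} (he : l e = 1) : g' e ≠ 0 := by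
  let _ := f.hom.toAlgebra
  let _ := g.hom.toAlgebra
  let _ := f'.hom.toAlgebra
  let _ := g'.hom.toAlgebra
  let _ := (f ≫ f').hom.toAlgebra
  have : IsScalarTower R A C := .of_algebraMap_eq' rfl
  have : IsScalarTower R B C := .of_algebraMap_eq' congr(($H.w).hom)
  have hP : Algebra.IsPushout R A B C := CommRingCat.isPushout_iff_isPushout.mp H
  let l' : B →ₗ[R] R :=
    { l with map_smul' := fun r x ↦ by rw [Algebra.smul_def]; exact hl r x }
  -- The base change of the linear form still takes the value `1` on the image of `e`.
  let L : C →ₗ[A] A := hP.out.lift (Algebra.linearMap R A ∘ₗ l')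
  intro h0
  have h1 : L (g' e) = algebraMap R A (l e) := hP.out.lift_eq _ e
  rw [h0, map_zero, he, map_one] at h1
  exact zero_ne_one h1

end Pushout

/-- Sections over affine opens of a fiber product form a pushout. -/
theorem isPushout_appLE {X Y S T : Scheme.{u}} {f : T ⟶ S} {g : Y ⟶ X} {iX : X ⟶ S} {iY : Y ⟶ T}
    (H : IsPullback g iY iX f) {US : S.Opens} {UT : T.Opens} {UX : X.Opens} {UY : Y.Opens}
    (hUS : IsAffineOpen US) (hUT : IsAffineOpen UT) (hUX : IsAffineOpen UX)
    (hUST : UT ≤ f ⁻¹ᵁ US) (hUSX : UX ≤ iX ⁻¹ᵁ US) (hUY : UY = g ⁻¹ᵁ UX ⊓ iY ⁻¹ᵁ UT) :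
    IsPushout (iX.appLE US UX hUSX) (f.appLE US UT hUST)
      (g.appLE UX UY (by simp [hUY])) (iY.appLE UT UY (by simp [hUY])) :=
  (isIso_pushoutSection_iff H hUST hUSX hUY).mp
    (isIso_pushoutSection_of_isAffineOpen H hUST hUSX hUY hUS hUT hUX)

variable {k : Type u} [Field k] {n : ℕ}

theorem isPullback_fst_snd (X Y : Over (Spec (.of k))) :
    IsPullback (fst X Y).left (snd X Y).left X.hom Y.hom :=
  IsPullback.of_hasPullback _ _

instance : IsAffine (Torus k n).left := inferInstanceAs (IsAffine (Spec _))

theorem isAffineOpen_tensor {X Y : Over (Spec (.of k))} [IsAffine X.left] {V : Y.left.Opens}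
    (hV : IsAffineOpen V) : IsAffineOpen ((snd X Y).left ⁻¹ᵁ V) := by
  have : IsAffineHom X.hom := isAffineHom_of_isAffine _
  have : IsAffineHom (snd X Y).left :=
    MorphismProperty.of_isPullback (P := @IsAffineHom) (isPullback_fst_snd X Y) this
  exact hV.preimage _

/-! ### Pullback of functions -/

/-- The pullback of functions along a morphism of `k`-schemes. -/
def pull {X Y : Over (Spec (.of k))} (f : X ⟶ Y) (V : Y.left.Opens) (W : X.left.Opens)
    (h : W ≤ f.left ⁻¹ᵁ V) : Γ(Y.left, V) →+* Γ(X.left, W) :=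
  (f.left.appLE V W h).hom

theorem pull_pull {X Y Z : Over (Spec (.of k))} (f : X ⟶ Y) (g : Y ⟶ Z) {U : Z.left.Opens}
    {V : Y.left.Opens} {W : X.left.Opens} (h : W ≤ f.left ⁻¹ᵁ V) (h' : V ≤ g.left ⁻¹ᵁ U)
    (x : Γ(Z.left, U)) :
    pull f V W h (pull g U V h' x) = pull (f ≫ g) U W (h.trans (f.left.preimage_mono h')) x :=
  congr($(Scheme.Hom.appLE_comp_appLE f.left g.left U V W h' h) x)

theorem pull_congr {X Y : Over (Spec (.of k))} {f g : X ⟶ Y} (e : f = g) {V : Y.left.Opens}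
    {W : X.left.Opens} (h : W ≤ f.left ⁻¹ᵁ V) (x : Γ(Y.left, V)) :
    pull f V W h x = pull g V W (e ▸ h) x := by
  subst e; rfl

theorem pull_id {X : Over (Spec (.of k))} (V : X.left.Opens) (x : Γ(X.left, V)) :
    pull (𝟙 X) V V le_rfl x = x :=
  congr($(X.left.presheaf.map_id (.op V)) x)

/-! ### Characters are group-like -/

theorem comp_SpecMap_appTop {A B : Type u} [CommRing A] [CommRing B] {P : Scheme.{u}}
    (h : P ⟶ Spec (.of B)) (φ : A →+* B) (a : A) :
    (h ≫ Spec.map (CommRingCat.ofHom φ)).appTop ((Scheme.ΓSpecIso (.of A)).inv a) =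
      h.appTop ((Scheme.ΓSpecIso (.of B)).inv (φ a)) := by
  rw [Scheme.Hom.comp_appTop, CommRingCat.comp_apply]
  exact congrArg h.appTop
    congr($(Scheme.ΓSpecIso_inv_naturality (CommRingCat.ofHom φ)) a).symm

/-- Under the identification of `T × T` with the spectrum of the tensor square, this is the formula
for the comultiplication on a monomial. -/
theorem appTop_mul_toFunction (χ : Character n) :
    (μ[Torus k n]).left.appTop (χ.toFunction k) =
      (fst (Torus k n) (Torus k n)).left.appTop (χ.toFunction k) *
        (snd (Torus k n) (Torus k n)).left.appTop (χ.toFunction k) := by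
  let A := AddMonoidAlgebra k (Character n)
  let h := (pullbackSpecIso k A A).hom
  let x : A := .single χ 1
  have hfst : (fst (Torus k n) (Torus k n)).left.appTop (χ.toFunction k) =
      h.appTop ((Scheme.ΓSpecIso (.of (A ⊗[k] A))).inv (x ⊗ₜ 1)) :=
    congr(Scheme.Hom.appTop $(pullbackSpecIso_hom_fst k A A) (χ.toFunction k)).symm.trans
      (comp_SpecMap_appTop h _ x)
  have hsnd : (snd (Torus k n) (Torus k n)).left.appTop (χ.toFunction k) =
      h.appTop ((Scheme.ΓSpecIso (.of (A ⊗[k] A))).inv (1 ⊗ₜ x)) :=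
    congr(Scheme.Hom.appTop $(pullbackSpecIso_hom_snd k A A) (χ.toFunction k)).symm.trans
      (comp_SpecMap_appTop h _ x)
  have hcomul : Coalgebra.comul (R := k) x = (x ⊗ₜ 1) * (1 ⊗ₜ x) := by
    refine (AddMonoidAlgebra.comul_single (R := k) χ (1 : k)).trans ?_
    simp [x]
  have hmul : (μ[Torus k n]).left.appTop (χ.toFunction k) =
      h.appTop ((Scheme.ΓSpecIso (.of (A ⊗[k] A))).inv ((x ⊗ₜ 1) * (1 ⊗ₜ x))) := by
    rw [← hcomul]
    exact comp_SpecMap_appTop h (Bialgebra.comulAlgHom k A).toRingHom x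
  refine hmul.trans (Eq.trans ?_ congr($hfst * $hsnd).symm)
  exact (congrArg h.appTop (map_mul (Scheme.ΓSpecIso (.of (A ⊗[k] A))).inv.hom _ _)).trans
    (map_mul h.appTop.hom _ _)

theorem appTop_one_toFunction (χ : Character n) :
    (η[Torus k n]).left.appTop (χ.toFunction k) = 1 := by
  let A := AddMonoidAlgebra k (Character n)
  have h : (η[Torus k n]).left.appTop (χ.toFunction k) =
      (Scheme.ΓSpecIso (.of k)).inv (Coalgebra.counit (R := k) (.single χ 1 : A)) :=
    congr($(Scheme.ΓSpecIso_inv_naturality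
      (CommRingCat.ofHom (Bialgebra.counitAlgHom k A).toRingHom)) (.single χ 1)).symm
  refine h.trans ?_
  have : Coalgebra.counit (R := k) (.single χ 1 : A) = 1 := by simp
  exact (congrArg (Scheme.ΓSpecIso (.of k)).inv this).trans
    (map_one (Scheme.ΓSpecIso (.of k)).inv.hom)

theorem toFunction_add (χ ψ : Character n) :
    (χ + ψ).toFunction k = χ.toFunction k * ψ.toFunction k := by
  have : (AddMonoidAlgebra.single (χ + ψ) 1 : AddMonoidAlgebra k (Character n)) =
      .single χ 1 * .single ψ 1 := by
    rw [AddMonoidAlgebra.single_mul_single, one_mul]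
  exact (congrArg (Scheme.ΓSpecIso (.of (AddMonoidAlgebra k (Character n)))).inv this).trans
    (map_mul (Scheme.ΓSpecIso (.of (AddMonoidAlgebra k (Character n)))).inv.hom _ _)

theorem toFunction_zero : (0 : Character n).toFunction k = 1 :=
  map_one (Scheme.ΓSpecIso (.of (AddMonoidAlgebra k (Character n)))).inv.hom

/-- The character `χ` as a function on `Z`, for a point `a : Z ⟶ T`. -/
def charAt {Z : Over (Spec (.of k))} (a : Z ⟶ Torus k n) (χ : Character n) (W : Z.left.Opens) :
    Γ(Z.left, W) :=
  pull a ⊤ W (le_preimage_top _ _) (χ.toFunction k)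

section charAt

variable {Z Z' : Over (Spec (.of k))} (a b : Z ⟶ Torus k n) (χ ψ : Character n)
  (W : Z.left.Opens)

theorem charAt_top : charAt a χ ⊤ = a.left.appTop (χ.toFunction k) :=
  congr($(Scheme.Hom.appLE_eq_app a.left (U := ⊤)) (χ.toFunction k))

theorem pull_charAt (g : Z' ⟶ Z) {W' : Z'.left.Opens} (h : W' ≤ g.left ⁻¹ᵁ W) :
    pull g W W' h (charAt a χ W) = charAt (g ≫ a) χ W' :=
  pull_pull _ _ _ _ _

theorem charAt_add : charAt a (χ + ψ) W = charAt a χ W * charAt a ψ W := by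
  unfold charAt
  rw [toFunction_add, map_mul]

theorem charAt_zero : charAt a (0 : Character n) W = 1 := by
  unfold charAt
  rw [toFunction_zero, map_one]

theorem charAt_mul : charAt (lift a b ≫ μ[Torus k n]) χ W = charAt a χ W * charAt b χ W := by
  have h : charAt μ[Torus k n] χ ⊤ = charAt (fst (Torus k n) (Torus k n)) χ ⊤ *
      charAt (snd (Torus k n) (Torus k n)) χ ⊤ := by
    simp only [charAt_top]
    exact appTop_mul_toFunction χ
  have h' := congrArg (pull (lift a b) ⊤ W (le_preimage_top _ _)) h
  rw [map_mul, pull_charAt, pull_charAt, pull_charAt] at h'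
  simpa using h'

theorem charAt_one (g : Z ⟶ 𝟙_ _) : charAt (g ≫ η[Torus k n]) χ W = 1 := by
  rw [← pull_charAt (W := ⊤) (h := le_preimage_top _ _)]
  have : charAt η[Torus k n] χ ⊤ = 1 := by
    rw [charAt_top]
    exact appTop_one_toFunction χ
  rw [this, map_one]

end charAt

/-! ### Functions on `T × Y` -/

section TorusProduct

variable (Y : Over (Spec (.of k))) (V : Y.left.Opens)

/-- The function `∑ χ * c χ` on `T × V`. -/
def charSum (c : Character n →₀ Γ(Y.left, V)) :
    Γ((Torus k n ⊗ Y).left, (snd (Torus k n) Y).left ⁻¹ᵁ V) :=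
  c.sum fun χ x ↦ charAt (fst (Torus k n) Y) χ _ * pull (snd (Torus k n) Y) V _ le_rfl x

variable {V} in
-- The monomials form a basis of the Laurent polynomials over `k`, and `T × V` is a base change of
-- `T`. Comparing coefficients of characters is what makes weight decompositions unique.
theorem charSum_bijective (hV : IsAffineOpen V) :
    Function.Bijective (charSum (n := n) Y V) := by
  have H := isPushout_appLE (isPullback_fst_snd (Torus k n) Y) (isAffineOpen_top _)
    hV (isAffineOpen_top _) (UY := (snd (Torus k n) Y).left ⁻¹ᵁ V) le_top le_top (by simp)
  let e : Γ((Torus k n).left, ⊤) ≅ .of (AddMonoidAlgebra k (Character n)) :=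
    Scheme.ΓSpecIso (.of (AddMonoidAlgebra k (Character n)))
  have H' : IsPushout (CommRingCat.ofHom (algebraMap k (AddMonoidAlgebra k (Character n))))
      ((Scheme.ΓSpecIso (.of k)).inv ≫ Y.hom.appLE ⊤ V le_top)
      (e.inv ≫ (fst (Torus k n) Y).left.appLE ⊤ ((snd (Torus k n) Y).left ⁻¹ᵁ V) le_top)
      ((snd (Torus k n) Y).left.appLE V _ le_rfl) := by
    refine H.of_iso (Scheme.ΓSpecIso (.of k)) e (Iso.refl _) (Iso.refl _) ?_ (by simp) (by simp)
      (by simp)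
    exact Scheme.ΓSpecIso_naturality
      (CommRingCat.ofHom (algebraMap k (AddMonoidAlgebra k (Character n))))
  have hk : Function.Bijective fun c : Character n →₀ k ↦
      c.sum fun χ r ↦ algebraMap k (AddMonoidAlgebra k (Character n)) r * .single χ 1 := by
    convert (AddMonoidAlgebra.basis (Character n) k).repr.symm.bijective with c
    rw [Module.Basis.repr_symm_apply, Finsupp.linearCombination_apply]
    exact Finsupp.sum_congr fun χ _ ↦ by rw [Algebra.smul_def, AddMonoidAlgebra.basis_apply]
  have hb := bijective_sum_of_isPushout H' hk
  convert hb with c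
  exact Finsupp.sum_congr fun χ _ ↦ by rfl

end TorusProduct

/-! ### The weight decomposition -/

section Decomposition

variable {X : Over (Spec (.of k))} [ModObj (Torus k n) X] {V : X.left.Opens}

/-- The open subset `V` is stable under the action of `T`. -/
def IsStable (n : ℕ) {X : Over (Spec (.of k))} [ModObj (Torus k n) X] (V : X.left.Opens) : Prop :=
  (act k n X).left ⁻¹ᵁ V = (snd (Torus k n) X).left ⁻¹ᵁ V

/-- The coaction `f ↦ ((t, x) ↦ f (t • x))` on the functions on a stable open subset. -/
def coaction (hV : IsStable n V) :
    Γ(X.left, V) →+* Γ((Torus k n ⊗ X).left, (snd (Torus k n) X).left ⁻¹ᵁ V) :=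
  pull (act k n X) V _ hV.ge

theorem mem_weightSpace_iff (hV : IsStable n V) {χ : Character n} {f : Γ(X.left, V)} :
    f ∈ weightSpace X χ V ↔ coaction hV f =
      charAt (fst (Torus k n) X) χ _ * pull (snd (Torus k n) X) V _ le_rfl f := by
  -- For stable `V` the two preimages in the definition coincide. A variable `W` avoids rewriting
  -- inside a dependent type.
  have key (W : (Torus k n ⊗ X).left.Opens) (hW : W = (snd (Torus k n) X).left ⁻¹ᵁ V)
      (h₁ : W ≤ (act k n X).left ⁻¹ᵁ V) :
      (act k n X).left.appLE V W h₁ f = (Torus k n ⊗ X).left.presheaf.map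
        (homOfLE (le_top : W ≤ ⊤)).op ((fst (Torus k n) X).left.appTop (χ.toFunction k)) *
          (snd (Torus k n) X).left.appLE V W hW.le f ↔
      coaction hV f =
        charAt (fst (Torus k n) X) χ _ * pull (snd (Torus k n) X) V _ le_rfl f := by
    subst hW; rfl
  exact key _ (by rw [hV, inf_idem]) inf_le_left

theorem mul_mem_weightSpace (hV : IsStable n V) {χ ψ : Character n} {f g : Γ(X.left, V)}
    (hf : f ∈ weightSpace X χ V) (hg : g ∈ weightSpace X ψ V) :
    f * g ∈ weightSpace X (χ + ψ) V := by
  rw [mem_weightSpace_iff hV] at *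
  rw [map_mul, hf, hg, charAt_add, map_mul]
  ring

theorem one_mem_weightSpace (hV : IsStable n V) :
    (1 : Γ(X.left, V)) ∈ weightSpace X (0 : Character n) V := by
  rw [mem_weightSpace_iff hV, map_one, charAt_zero, map_one, one_mul]

theorem charSum_single (Y : Over (Spec (.of k))) (V : Y.left.Opens) (χ : Character n)
    (x : Γ(Y.left, V)) : charSum Y V (.single χ x) =
      charAt (fst (Torus k n) Y) χ _ * pull (snd (Torus k n) Y) V _ le_rfl x :=
  Finsupp.sum_single_index (by rw [map_zero, mul_zero])

theorem charSum_add (Y : Over (Spec (.of k))) (V : Y.left.Opens)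
    (c d : Character n →₀ Γ(Y.left, V)) : charSum Y V (c + d) = charSum Y V c + charSum Y V d :=
  Finsupp.sum_add_index' (fun _ ↦ by rw [map_zero, mul_zero])
    (fun _ _ _ ↦ by rw [map_add, mul_add])

theorem mem_weightSpace_iff_charSum (hV : IsStable n V) {χ : Character n} {f : Γ(X.left, V)} :
    f ∈ weightSpace X χ V ↔ charSum X V (.single χ f) = coaction hV f := by
  rw [mem_weightSpace_iff hV, charSum_single, eq_comm]

/-- The coefficients of a coaction are semiinvariant. -/
theorem mem_weightSpace_of_charSum_eq (hVa : IsAffineOpen V) (hV : IsStable n V)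
    {c : Character n →₀ Γ(X.left, V)} {f : Γ(X.left, V)} (hc : charSum X V c = coaction hV f)
    (χ : Character n) : c χ ∈ weightSpace X χ V := by
  let T := Torus k n
  let W := (snd T X).left ⁻¹ᵁ V
  let W' := (snd T (T ⊗ X)).left ⁻¹ᵁ W
  have hW : IsAffineOpen W := isAffineOpen_tensor hVa
  -- the maps `(s, t, x) ↦ (s, t • x)` and `(s, t, x) ↦ (s * t, x)`
  let a : T ⊗ (T ⊗ X) ⟶ T ⊗ X := T ◁ act k n X
  let m : T ⊗ (T ⊗ X) ⟶ T ⊗ X := (α_ T T X).inv ≫ μ[T] ▷ X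
  have ha_snd : a ≫ snd T X = snd T (T ⊗ X) ≫ act k n X := by simp [a]
  have ha_fst : a ≫ fst T X = fst T (T ⊗ X) := by simp [a]
  have hm_snd : m ≫ snd T X = snd T (T ⊗ X) ≫ snd T X := by simp [m]
  have hm_fst : m ≫ fst T X = lift (fst T (T ⊗ X)) (snd T (T ⊗ X) ≫ fst T X) ≫ μ[T] := by
    simp only [m, Category.assoc, whiskerRight_fst]
    rw [← Category.assoc]
    congr 1
    ext : 1 <;> simp
  have ham : a ≫ act k n X = m ≫ act k n X := by
    have := ModObj.mul_smul (M := T) X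
    exact (Iso.inv_comp_eq _).mpr this |>.symm.trans (Category.assoc _ _ _).symm
  have haW : W' ≤ a.left ⁻¹ᵁ W := by
    refine le_of_eq ?_
    change (snd T (T ⊗ X)).left ⁻¹ᵁ (snd T X).left ⁻¹ᵁ V = (a ≫ snd T X).left ⁻¹ᵁ V
    rw [ha_snd]
    exact congrArg ((snd T (T ⊗ X)).left ⁻¹ᵁ ·) hV.symm
  have hmW : W' ≤ m.left ⁻¹ᵁ W := by
    refine le_of_eq ?_
    change (snd T (T ⊗ X)).left ⁻¹ᵁ (snd T X).left ⁻¹ᵁ V = (m ≫ snd T X).left ⁻¹ᵁ V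
    rw [hm_snd]
    rfl
  have hleft : pull a W W' haW (charSum X V c) =
      charSum (T ⊗ X) W (c.mapRange (coaction hV) (map_zero _)) := by
    unfold charSum
    rw [Finsupp.sum_mapRange_index fun _ ↦ by rw [map_zero, mul_zero], map_finsuppSum]
    refine Finsupp.sum_congr fun ψ _ ↦ ?_
    rw [map_mul, pull_charAt, pull_pull, coaction, pull_pull, pull_congr ha_snd, ha_fst]
  let d : Character n →₀ Γ((T ⊗ X).left, W) := Finsupp.onFinset c.support
    (fun ψ ↦ charAt (fst T X) ψ W * pull (snd T X) V W le_rfl (c ψ)) fun ψ hψ ↦ by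
      rw [Finsupp.mem_support_iff]
      intro h
      rw [h, map_zero, mul_zero] at hψ
      exact hψ rfl
  have hright : pull m W W' hmW (charSum X V c) = charSum (T ⊗ X) W d := by
    unfold charSum
    rw [Finsupp.onFinset_sum _ fun _ ↦ by rw [map_zero, mul_zero], map_finsuppSum]
    refine Finset.sum_congr rfl fun ψ _ ↦ ?_
    beta_reduce
    rw [map_mul, pull_charAt, pull_pull, map_mul, pull_charAt, pull_pull, pull_congr hm_snd,
      hm_fst, charAt_mul, mul_assoc]
  -- Associativity of the action expands `f (s • t • x)` in characters of `s` in two ways; the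
  -- coefficients agree.
  have hcd : c.mapRange (coaction hV) (map_zero _) = d := by
    apply (charSum_bijective (T ⊗ X) hW).injective
    rw [← hleft, ← hright, hc, coaction, pull_pull, pull_pull, pull_congr ham]
  rw [mem_weightSpace_iff hV]
  exact DFunLike.congr_fun hcd χ

/-- Restrict the expansion of `f (t • x)` to `t = 1`, where every character has the value `1`. -/
theorem sum_eq_of_charSum_eq (hV : IsStable n V)
    {c : Character n →₀ Γ(X.left, V)} {f : Γ(X.left, V)} (hc : charSum X V c = coaction hV f) :
    (c.sum fun _ x ↦ x) = f := by
  let T := Torus k n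
  let σ : X ⟶ T ⊗ X := (λ_ X).inv ≫ η[T] ▷ X
  have hsnd : σ ≫ snd T X = 𝟙 X := by
    rw [Category.assoc, whiskerRight_snd, leftUnitor_inv_snd]
  have hfst : σ ≫ fst T X = toUnit X ≫ η[T] := by
    simp only [σ, Category.assoc, whiskerRight_fst]
    rw [← Category.assoc]
    congr 1
    exact toUnit_unique _ _
  have hact : σ ≫ act k n X = 𝟙 X := by
    have := ModObj.one_smul (M := T) X
    exact (Category.assoc _ _ _).trans ((Iso.inv_comp_eq _).mpr (this.trans (Category.comp_id _).symm))
  have hσ : V ≤ σ.left ⁻¹ᵁ (snd T X).left ⁻¹ᵁ V := by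
    refine le_of_eq ?_
    change V = (σ ≫ snd T X).left ⁻¹ᵁ V
    rw [hsnd]
    rfl
  have h := congrArg (pull σ _ V hσ) hc
  rw [coaction, pull_pull, pull_congr hact, pull_id, charSum, map_finsuppSum] at h
  rw [← h]
  refine Finsupp.sum_congr fun ψ _ ↦ ?_
  rw [map_mul, pull_charAt, hfst, charAt_one, one_mul, pull_pull, pull_congr hsnd, pull_id]

/-- The family of the homogeneous components of the functions on a stable affine open subset. -/
def weightComponents (hVa : IsAffineOpen V) (hV : IsStable n V) :
    Γ(X.left, V) →+ (Character n →₀ Γ(X.left, V)) :=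
  (AddEquiv.ofBijective (AddMonoidHom.mk' (charSum (n := n) X V) (charSum_add X V))
    (charSum_bijective X hVa)).symm.toAddMonoidHom.comp (coaction hV).toAddMonoidHom

variable (hVa : IsAffineOpen V) (hV : IsStable n V)

theorem charSum_weightComponents (f : Γ(X.left, V)) :
    charSum X V (weightComponents hVa hV f) = coaction hV f :=
  (AddEquiv.ofBijective (AddMonoidHom.mk' (charSum X V) (charSum_add X V))
    (charSum_bijective X hVa)).apply_symm_apply (coaction hV f)

theorem weightComponents_mem (f : Γ(X.left, V)) (χ : Character n) :
    weightComponents hVa hV f χ ∈ weightSpace X χ V :=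
  mem_weightSpace_of_charSum_eq hVa hV (charSum_weightComponents hVa hV f) χ

theorem sum_weightComponents (f : Γ(X.left, V)) :
    ((weightComponents hVa hV f).sum fun _ x ↦ x) = f :=
  sum_eq_of_charSum_eq hV (charSum_weightComponents hVa hV f)

theorem weightComponents_of_mem {f : Γ(X.left, V)} {χ : Character n} (hf : f ∈ weightSpace X χ V) :
    weightComponents hVa hV f = .single χ f := by
  apply (charSum_bijective X hVa).injective
  rw [charSum_weightComponents, (mem_weightSpace_iff_charSum hV).mp hf]

/-- By additivity `g` may be taken homogeneous; then only cancellation of `χ` in the character group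
is needed. -/
theorem weightComponents_mul {f g : Γ(X.left, V)} {χ : Character n} (hf : f ∈ weightSpace X χ V)
    (ψ : Character n) :
    weightComponents hVa hV (f * g) (χ + ψ) = f * weightComponents hVa hV g ψ := by
  have key (φ : Character n) (x : Γ(X.left, V)) (hx : x ∈ weightSpace X φ V) :
      weightComponents hVa hV (f * x) (χ + ψ) = f * weightComponents hVa hV x ψ := by
    rw [weightComponents_of_mem hVa hV hx,
      weightComponents_of_mem hVa hV (mul_mem_weightSpace hV hf hx)]
    by_cases h : φ = ψ
    · rw [h, Finsupp.single_eq_same, Finsupp.single_eq_same]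
    · rw [Finsupp.single_eq_of_ne (Ne.symm h),
        Finsupp.single_eq_of_ne (by simpa using Ne.symm h), mul_zero]
  conv_lhs => rw [← sum_weightComponents hVa hV g]
  conv_rhs => rw [← sum_weightComponents hVa hV g]
  rw [Finsupp.mul_sum, Finsupp.sum, Finsupp.sum, map_sum, map_sum, Finsupp.finsetSum_apply,
    Finsupp.finsetSum_apply, Finset.mul_sum]
  exact Finset.sum_congr rfl fun φ _ ↦ key φ _ (weightComponents_mem hVa hV g φ)

end Decomposition

theorem isStable_preimage {X S : Over (Spec (.of k))} [ModObj (Torus k n) X] {p : X ⟶ S}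
    (hp : IsInvariant n p) (U : S.left.Opens) : IsStable n (p.left ⁻¹ᵁ U) :=
  congrArg (fun g : Torus k n ⊗ X ⟶ S ↦ g.left ⁻¹ᵁ U) hp

theorem isStable_top {X : Over (Spec (.of k))} [ModObj (Torus k n) X] :
    IsStable n (⊤ : X.left.Opens) := rfl

/-! ### Evaluation at geometric points -/

/-- A geometric point over the point `s`. -/
def geometricPoint (S : Scheme.{u}) (s : S) :
    Spec (.of (AlgebraicClosure (S.residueField s))) ⟶ S :=
  Spec.map (CommRingCat.ofHom (algebraMap (S.residueField s)
    (AlgebraicClosure (S.residueField s)))) ≫ S.fromSpecResidueField s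

theorem geometricPoint_apply (S : Scheme.{u}) (s : S)
    (x : Spec (.of (AlgebraicClosure (S.residueField s)))) : geometricPoint S s x = s := by
  rw [geometricPoint, Scheme.Hom.comp_apply, Scheme.fromSpecResidueField_apply]

theorem geometricPoint_preimage (S : Scheme.{u}) (s : S) {U : S.Opens} (hs : s ∈ U) :
    geometricPoint S s ⁻¹ᵁ U = ⊤ := by
  ext x
  simp [geometricPoint_apply, hs]

namespace DirectImage

variable {X S : Over (Spec (.of k))} (p : X ⟶ S)

/-- The functions on the geometric fiber of `p` at the point `s`. -/
abbrev FiberSections (s : S.left) : CommRingCat.{u} :=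
  Γ(pullback p.left (geometricPoint S.left s), ⊤)

theorem fst_preimage (s : S.left) {U : S.left.Opens} (hs : s ∈ U) :
    (pullback.fst p.left (geometricPoint S.left s)) ⁻¹ᵁ p.left ⁻¹ᵁ U = ⊤ := by
  have h : (pullback.fst p.left (geometricPoint S.left s)) ⁻¹ᵁ p.left ⁻¹ᵁ U =
      (pullback.snd p.left (geometricPoint S.left s)) ⁻¹ᵁ geometricPoint S.left s ⁻¹ᵁ U :=
    congrArg (fun g : pullback p.left (geometricPoint S.left s) ⟶ S.left ↦ g ⁻¹ᵁ U)
      Limits.pullback.condition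
  rw [h, geometricPoint_preimage _ _ hs]
  rfl

/-- The restriction of functions to the geometric fiber of `p` at the point `s`. -/
def eval {s : S.left} {U : S.left.Opens} (hs : s ∈ U) : DirectImage p U →+* FiberSections p s :=
  ((pullback.fst p.left (geometricPoint S.left s)).appLE (p.left ⁻¹ᵁ U) ⊤
    (fst_preimage p s hs).ge).hom

theorem res_algebraMap {U V : S.left.Opens} (h : V ≤ U) (c : Γ(S.left, U)) :
    res p h (algebraMap _ _ c) = algebraMap _ _ (S.left.presheaf.map (homOfLE h).op c) := by
  have h₁ := p.left.appLE_map (U := U) le_rfl (homOfLE (p.left.preimage_mono h)).op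
  have h₂ := p.left.map_appLE (V := p.left ⁻¹ᵁ V) le_rfl (homOfLE h).op
  exact congr($(h₁.trans h₂.symm) c)

theorem res_res {U V W : S.left.Opens} (h : V ≤ U) (h' : W ≤ V) (f : DirectImage p U) :
    res p h' (res p h f) = res p (h'.trans h) f :=
  congr($(X.left.presheaf.map_comp (homOfLE (p.left.preimage_mono h)).op
    (homOfLE (p.left.preimage_mono h')).op) f).symm

theorem eval_res {s : S.left} {U V : S.left.Opens} (h : V ≤ U) (hs : s ∈ V) (f : DirectImage p U) :
    eval p hs (res p h f) = eval p (h hs) f :=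
  congr($((pullback.fst p.left (geometricPoint S.left s)).map_appLE
    (fst_preimage p s hs).ge (homOfLE (p.left.preimage_mono h)).op) f)

/-- The pullback of `c` to the geometric point has empty non-vanishing locus, so it is zero because
the spectrum of a field is reduced. -/
theorem eval_algebraMap_eq_zero {s : S.left} {U : S.left.Opens} (hs : s ∈ U) {c : Γ(S.left, U)}
    (hc : s ∉ S.left.basicOpen c) : eval p hs (algebraMap _ _ c) = 0 := by
  have h₀ : (geometricPoint S.left s).appLE U ⊤ (geometricPoint_preimage _ _ hs).ge c = 0 := by
    rw [← basicOpen_eq_bot_iff, Scheme.basicOpen_appLE, eq_bot_iff]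
    rintro x ⟨-, hx⟩
    rw [← geometricPoint_apply S.left s x] at hc
    exact hc hx
  have h₁ := (pullback.fst p.left (geometricPoint S.left s)).appLE_comp_appLE p.left U _ _
    (le_refl _) (fst_preimage p s hs).ge
  have h₂ := (pullback.snd p.left (geometricPoint S.left s)).appLE_comp_appLE
    (geometricPoint S.left s) U ⊤ ⊤ (geometricPoint_preimage _ _ hs).ge le_top
  have h₃ : eval p hs (algebraMap _ _ c) = (pullback.snd p.left (geometricPoint S.left s)).appLE ⊤ ⊤
      le_top ((geometricPoint S.left s).appLE U ⊤ (geometricPoint_preimage _ _ hs).ge c) := by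
    refine congr($h₁ c).trans (Eq.trans ?_ congr($h₂ c).symm)
    congr 3
    exact Limits.pullback.condition
  rw [h₃, h₀, map_zero]

theorem res_mem_weightSheaf [ModObj (Torus k n) X] {p : X ⟶ S} (hp : IsInvariant n p)
    {χ : Character n} {U V : S.left.Opens} (h : V ≤ U) {f : DirectImage p U}
    (hf : f ∈ weightSheaf hp χ U) : res p h f ∈ weightSheaf hp χ V := by
  have := appLE_mem_weightSpace (q := 𝟙 X) (n := n) inferInstance hf
    (W := p.left ⁻¹ᵁ V) (p.left.preimage_mono h)
  have e : res p h f = (𝟙 X : X ⟶ X).left.appLE (p.left ⁻¹ᵁ U) (p.left ⁻¹ᵁ V)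
      (p.left.preimage_mono h) f :=
    congr($(Category.id_comp (X.left.presheaf.map (homOfLE (p.left.preimage_mono h)).op)) f).symm
  exact (congrArg (· ∈ weightSpace X χ (p.left ⁻¹ᵁ V)) e).mpr this

variable [ModObj (Torus k n) X] {p : X ⟶ S} (hp : IsInvariant n p)

theorem algebraMap_mem_weightSheaf (U : S.left.Opens) (c : Γ(S.left, U)) :
    algebraMap _ (DirectImage p U) c ∈ weightSheaf hp (0 : Character n) U := by
  rw [Algebra.algebraMap_eq_smul_one]
  exact Submodule.smul_mem _ _ (one_mem_weightSpace (isStable_preimage hp U))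

/-- A local basis of a weight sheaf of rank `1` does not vanish on the geometric fibers. -/
theorem eval_basis_ne_zero [IsAffineHom p.left] {χ : Character n} {s : S.left} {U : S.left.Opens}
    (hU : IsAffineOpen U) (hs : s ∈ U)
    (b : Module.Basis (Fin 1) Γ(S.left, U) (weightSheaf hp χ U)) :
    eval p hs (b 0 : DirectImage p U) ≠ 0 := by
  have hVa : IsAffineOpen (p.left ⁻¹ᵁ U) := hU.preimage p.left
  have hV := isStable_preimage hp U
  let G := geometricPoint S.left s
  have H := isPushout_appLE (IsPullback.of_hasPullback p.left G).flip hU hVa (isAffineOpen_top _)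
    (le_refl _) (geometricPoint_preimage _ _ hs).ge (UY := ⊤)
    (by rw [fst_preimage p s hs]; simp)
  have : Nontrivial Γ(Spec (.of (AlgebraicClosure (S.left.residueField s))), ⊤) :=
    (Scheme.ΓSpecIso _).commRingCatIsoToRingEquiv.nontrivial
  -- The linear form is the coordinate of the component of weight `χ`. It is linear over `𝒪_S`
  -- because functions from `S` have weight zero, and its value on `b 0` is `1`.
  let l : Γ(X.left, p.left ⁻¹ᵁ U) →+ Γ(S.left, U) :=
    { toFun := fun x ↦ b.repr ⟨weightComponents hVa hV x χ, weightComponents_mem hVa hV x χ⟩ 0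
      map_zero' := by
        rw [← Finsupp.zero_apply (M := Γ(S.left, U)) (a := (0 : Fin 1)), ← map_zero b.repr]
        congr 2
        exact Subtype.ext congr($(map_zero (weightComponents hVa hV)) χ)
      map_add' := fun x y ↦ by
        rw [← Finsupp.add_apply, ← map_add b.repr]
        congr 2
        exact Subtype.ext congr($(map_add (weightComponents hVa hV) x y) χ) }
  refine ne_zero_of_isPushout H l (fun c x ↦ ?_) ?_
  · change b.repr _ 0 = c • b.repr _ 0
    rw [← Finsupp.smul_apply, ← map_smul b.repr]
    congr 2
    refine Subtype.ext ?_
    have := weightComponents_mul hVa hV (algebraMap_mem_weightSheaf hp U c) χ (g := x)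
    rw [zero_add] at this
    exact this.trans (Algebra.smul_def (A := DirectImage p U) _ _).symm
  · have h : (⟨weightComponents hVa hV (b 0).1 χ, weightComponents_mem hVa hV _ χ⟩ :
        weightSheaf hp χ U) = b 0 :=
      Subtype.ext (congr($(weightComponents_of_mem hVa hV (b 0).2) χ).trans Finsupp.single_eq_same)
    change b.repr _ 0 = 1
    rw [h, b.repr_self, Finsupp.single_eq_same]

/-- A section of a weight sheaf of rank at most `1` that does not vanish on the geometric fiber at a
point generates the weight sheaf near this point. -/
theorem exists_generates_of_eval_ne_zero {χ : Character n} {r : ℕ} (hr : r ≤ 1)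
    (hχ : IsLocallyFreeOfRank hp χ r) {s : S.left} {U : S.left.Opens} (hs : s ∈ U)
    {g : DirectImage p U} (hg : g ∈ weightSheaf hp χ U) (hgs : eval p hs g ≠ 0) :
    ∃ (V : S.left.Opens) (hVU : V ≤ U), s ∈ V ∧ ∀ (W : S.left.Opens) (hW : W ≤ V),
      ∀ h ∈ weightSheaf hp χ W, ∃ c : Γ(S.left, W), h = c • res p (hW.trans hVU) g := by
  obtain ⟨U', hsU', e, he⟩ := hχ s
  obtain ⟨b, hb⟩ := he (U ⊓ U') inf_le_right
  have hs' : s ∈ U ⊓ U' := ⟨hs, hsU'⟩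
  let g' : weightSheaf hp χ (U ⊓ U') := ⟨res p inf_le_left g, res_mem_weightSheaf hp _ hg⟩
  have hg' : eval p hs' g'.1 ≠ 0 := by rwa [eval_res]
  interval_cases r
  · have : g' = 0 := b.ext_elem fun i ↦ i.elim0
    rw [this, Submodule.coe_zero, map_zero] at hg'
    exact absurd rfl hg'
  · let c := b.repr g' 0
    have hc : (g' : DirectImage p (U ⊓ U')) = algebraMap _ _ c * b 0 := by
      rw [← Algebra.smul_def, ← Submodule.coe_smul]
      congr 1
      simpa using (b.sum_repr g').symm
    -- The coordinate of `g` cannot vanish at `s`, so it is a unit on its basic open set.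
    have hsc : s ∈ S.left.basicOpen c := by
      by_contra h
      rw [hc, map_mul, eval_algebraMap_eq_zero p hs' h, zero_mul] at hg'
      exact hg' rfl
    have hcU := S.left.basicOpen_le c
    refine ⟨S.left.basicOpen c, hcU.trans inf_le_left, hsc, fun W hW h hh ↦ ?_⟩
    obtain ⟨b', hb'⟩ := he W (hW.trans (hcU.trans inf_le_right))
    let cW := S.left.presheaf.map (homOfLE (hW.trans hcU)).op c
    have hcW : IsUnit cW := by
      have := (S.left.toRingedSpace.isUnit_res_basicOpen c).map
        (S.left.presheaf.map (homOfLE hW).op).hom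
      convert this
      exact congr($(S.left.presheaf.map_comp (homOfLE hcU).op (homOfLE hW).op) c)
    obtain ⟨d, hd⟩ := hcW.exists_left_inv
    refine ⟨b'.repr ⟨h, hh⟩ 0 * d, ?_⟩
    have h₁ : h = b'.repr ⟨h, hh⟩ 0 • (b' 0 : DirectImage p W) := by
      have := congrArg Subtype.val (b'.sum_repr ⟨h, hh⟩)
      simpa using this.symm
    have h₂ : res p ((hW.trans hcU).trans inf_le_left) g = cW • (b' 0 : DirectImage p W) := by
      have := congrArg (res p (hW.trans hcU)) hc
      rw [res_res, map_mul, res_algebraMap, hb, res_res] at this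
      rw [this, hb', Algebra.smul_def]
    rw [h₂, smul_smul, mul_assoc, hd, mul_one, ← h₁]

end DirectImage

/-! ### Homogeneous generators -/

section Monomials

variable {J : Type*} [Fintype J]

/-- The monomial with exponents `a` in the elements `f`. -/
def monomial {R : Type*} [CommMonoid R] (f : J → R) (a : J → ℕ) : R := ∏ i, f i ^ a i

theorem monomial_add {R : Type*} [CommMonoid R] (f : J → R) (a b : J → ℕ) :
    monomial f (a + b) = monomial f a * monomial f b := by
  simp [monomial, pow_add, Finset.prod_mul_distrib]

theorem monomial_smul {R : Type*} [CommMonoid R] (f : J → R) (d : ℕ) (a : J → ℕ) :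
    monomial f (d • a) = monomial f a ^ d := by
  simp [monomial, pow_mul', Finset.prod_pow]

/-- The weight of the monomial with exponents `a` in elements of weights `w`. -/
def monomialWeight (w : J → Character n) (a : J → ℕ) : Character n := ∑ i, a i • w i

theorem monomialWeight_add (w : J → Character n) (a b : J → ℕ) :
    monomialWeight w (a + b) = monomialWeight w a + monomialWeight w b := by
  simp [monomialWeight, add_smul, Finset.sum_add_distrib]

theorem monomialWeight_smul (w : J → Character n) (d : ℕ) (a : J → ℕ) :
    monomialWeight w (d • a) = d • monomialWeight w a := by
  simp [monomialWeight, Finset.smul_sum, mul_smul]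

variable {X : Over (Spec (.of k))} [ModObj (Torus k n) X] {V : X.left.Opens}

theorem pow_mem_weightSpace (hV : IsStable n V) {χ : Character n} {f : Γ(X.left, V)}
    (hf : f ∈ weightSpace X χ V) (d : ℕ) : f ^ d ∈ weightSpace X (d • χ) V := by
  induction d with
  | zero => rw [pow_zero, zero_smul]; exact one_mem_weightSpace hV
  | succ d ih => rw [pow_succ, succ_nsmul]; exact mul_mem_weightSpace hV ih hf

theorem monomial_mem_weightSpace (hV : IsStable n V) {w : J → Character n} {f : J → Γ(X.left, V)}
    (hf : ∀ i, f i ∈ weightSpace X (w i) V) (a : J → ℕ) :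
    monomial f a ∈ weightSpace X (monomialWeight w a) V := by
  classical
  unfold monomial monomialWeight
  induction (Finset.univ : Finset J) using Finset.induction_on with
  | empty => exact one_mem_weightSpace hV
  | insert i s hi ih =>
    rw [Finset.prod_insert hi, Finset.sum_insert hi]
    exact mul_mem_weightSpace hV (pow_mem_weightSpace hV (hf i) _) ih

end Monomials

/-- The algebra of functions on an affine `T`-scheme of finite type is generated by finitely many
nonzero semiinvariants. -/
theorem exists_homogeneous_generators (X : Over (Spec (.of k))) [ModObj (Torus k n) X]
    [IsAffine X.left] [LocallyOfFiniteType X.hom] :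
    ∃ (m : ℕ) (f : Fin m → Γ(X.left, ⊤)) (w : Fin m → Character n),
      (∀ i, f i ∈ weightSpace X (w i) ⊤) ∧ (∀ i, f i ≠ 0) ∧
        Algebra.adjoin k (Set.range f) = ⊤ := by
  classical
  have hfin : Algebra.FiniteType k Γ(X.left, ⊤) := by
    have h₁ := X.hom.finiteType_appLE (isAffineOpen_top _) (isAffineOpen_top X.left)
      (le_preimage_top _ _)
    have h₂ : ((Scheme.ΓSpecIso (.of k)).inv).hom.FiniteType :=
      RingHom.FiniteType.of_surjective _
        (Scheme.ΓSpecIso (.of k)).symm.commRingCatIsoToRingEquiv.surjective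
    exact RingHom.FiniteType.comp h₁ h₂
  obtain ⟨s, hs⟩ := hfin.out
  let c := weightComponents (n := n) (isAffineOpen_top X.left) isStable_top
  -- The nonzero components of a finite generating set, each stored with its weight.
  let P : Finset (Γ(X.left, ⊤) × Character n) :=
    (s.biUnion fun x ↦ (c x).support.image fun χ ↦ (c x χ, χ))
  have hP {y : Γ(X.left, ⊤) × Character n} :
      y ∈ P ↔ ∃ x ∈ s, ∃ χ, c x χ ≠ 0 ∧ (c x χ, χ) = y := by simp [P]
  refine ⟨P.card, fun i ↦ (P.equivFin.symm i).1.1, fun i ↦ (P.equivFin.symm i).1.2,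
    fun i ↦ ?_, fun i ↦ ?_, ?_⟩
  · obtain ⟨x, -, χ, -, h⟩ := hP.mp (P.equivFin.symm i).2
    beta_reduce
    rw [← h]
    exact weightComponents_mem _ _ x χ
  · obtain ⟨x, -, χ, h₀, h⟩ := hP.mp (P.equivFin.symm i).2
    beta_reduce
    rwa [← h]
  · rw [eq_top_iff, ← hs, Algebra.adjoin_le_iff]
    intro x hx
    rw [SetLike.mem_coe, ← sum_weightComponents (isAffineOpen_top X.left) (isStable_top (n := n)) x]
    refine Subalgebra.sum_mem _ fun χ hχ ↦ Algebra.subset_adjoin ?_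
    let y : P := ⟨(c x χ, χ), hP.mpr ⟨x, hx, χ, Finsupp.mem_support_iff.mp hχ, rfl⟩⟩
    exact ⟨P.equivFin y, by simp [y, c]⟩

/-! ### Functions pulled back from the target -/

namespace DirectImage

variable {𝕏 X S : Over (Spec (.of k))}

/-- The pullback of functions on `𝕏` to functions on `X` over an open subset of `S`. -/
def ofTarget (p : X ⟶ S) (q : X ⟶ 𝕏) (U : S.left.Opens) : Γ(𝕏.left, ⊤) →+* DirectImage p U :=
  (q.left.appLE ⊤ (p.left ⁻¹ᵁ U) (le_preimage_top _ _)).hom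

theorem res_ofTarget (p : X ⟶ S) (q : X ⟶ 𝕏) {U V : S.left.Opens} (h : V ≤ U)
    (f : Γ(𝕏.left, ⊤)) : res p h (ofTarget p q U f) = ofTarget p q V f :=
  congr($(q.left.appLE_map (U := ⊤) (le_preimage_top _ _)
    (homOfLE (p.left.preimage_mono h)).op) f)

theorem ofTarget_mem_weightSheaf [ModObj (Torus k n) 𝕏] [ModObj (Torus k n) X] {p : X ⟶ S}
    {q : X ⟶ 𝕏} (hp : IsInvariant n p) (hq : IsModHom (Torus k n) q) {χ : Character n}
    {f : Γ(𝕏.left, ⊤)} (hf : f ∈ weightSpace 𝕏 χ ⊤) (U : S.left.Opens) :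
    ofTarget p q U f ∈ weightSheaf hp χ U :=
  appLE_mem_weightSpace hq hf _

theorem ofTarget_algebraMap (p : X ⟶ S) (q : X ⟶ 𝕏) (U : S.left.Opens) (c : k) :
    ofTarget p q U (algebraMap k _ c) = algebraMap Γ(S.left, U) (DirectImage p U)
      (algebraMap k _ c) :=
  (appLE_algebraMap q _ _ (le_preimage_top _ _) c).trans (appLE_algebraMap p U _ le_rfl c).symm

/-- If `X` is finite over `S × 𝕏`, then the functions on `X` are integral over the functions that
come from `S` and `𝕏`. -/
theorem exists_integral_equation {p : X ⟶ S} {q : X ⟶ 𝕏} [IsAffine 𝕏.left]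
    [IsFinite (lift p q).left] {U : S.left.Opens} (hU : IsAffineOpen U) (x : DirectImage p U) :
    ∃ (m : ℕ) (c : ℕ → DirectImage p U),
      (∀ j, c j ∈ Subring.closure (Set.range (algebraMap Γ(S.left, U) (DirectImage p U)) ∪
        Set.range (ofTarget p q U))) ∧
      x ^ m + ∑ j ∈ Finset.range m, c j * x ^ j = 0 := by
  let O : (S ⊗ 𝕏).left.Opens := (fst S 𝕏).left ⁻¹ᵁ U
  have hO : IsAffineOpen O := by
    have : IsAffineHom 𝕏.hom := isAffineHom_of_isAffine _
    have : IsAffineHom (fst S 𝕏).left :=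
      MorphismProperty.of_isPullback (P := @IsAffineHom) (isPullback_fst_snd S 𝕏).flip this
    exact hU.preimage _
  -- Here `O` is `U × 𝕏`, which is affine, so finiteness gives integrality over its functions.
  have hint (W : X.left.Opens) (hW : W = (lift p q).left ⁻¹ᵁ O) :
      (pull (lift p q) O W hW.le).IsIntegral := by
    subst hW
    have := (lift p q).left.isIntegral_app O hO
    rwa [Scheme.Hom.app_eq_appLE] at this
  have hpO : p.left ⁻¹ᵁ U = (lift p q).left ⁻¹ᵁ O := by
    conv_lhs => rw [← lift_fst p q]
    rfl
  let φ : Γ((S ⊗ 𝕏).left, O) →+* DirectImage p U := pull (lift p q) O (p.left ⁻¹ᵁ U) hpO.le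
  have hφ (y : Γ((S ⊗ 𝕏).left, O)) :
      φ y ∈ Subring.closure (Set.range (algebraMap Γ(S.left, U) (DirectImage p U)) ∪
        Set.range (ofTarget p q U)) := by
    have hcl := closure_range_of_isPushout (isPushout_appLE (isPullback_fst_snd S 𝕏)
      (isAffineOpen_top _) (isAffineOpen_top 𝕏.left) hU (le_preimage_top _ _)
      (le_preimage_top _ _) (UY := O) (by simp [O]))
    have hy := hcl.ge (Subring.mem_top y)
    induction hy using Subring.closure_induction with
    | mem z hz =>
      apply Subring.subset_closure
      obtain ⟨c, rfl⟩ | ⟨f, rfl⟩ := hz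
      · exact .inl ⟨c, ((pull_pull (lift p q) (fst S 𝕏) hpO.le le_rfl c).trans
          (pull_congr (lift_fst p q) _ c)).symm⟩
      · exact .inr ⟨f, ((pull_pull (lift p q) (snd S 𝕏) hpO.le (le_preimage_top _ _) f).trans
          (pull_congr (lift_snd p q) _ f)).symm⟩
    | zero => rw [map_zero]; exact zero_mem _
    | one => rw [map_one]; exact one_mem _
    | add y z _ _ hy hz => rw [map_add]; exact add_mem hy hz
    | neg y _ hy => rw [map_neg]; exact neg_mem hy
    | mul y z _ _ hy hz => rw [map_mul]; exact mul_mem hy hz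
  obtain ⟨P, hP, hx⟩ := hint _ hpO x
  replace hx : P.eval₂ φ x = 0 := hx
  refine ⟨P.natDegree, fun j ↦ φ (P.coeff j), fun j ↦ hφ _, ?_⟩
  rw [Polynomial.eval₂_eq_sum_range, Finset.sum_range_succ, hP.coeff_natDegree, map_one, one_mul,
    add_comm] at hx
  exact hx

end DirectImage

namespace DirectImage

/-! ### Homogeneous components of sections of a direct image -/

section Components

variable {X S : Over (Spec (.of k))} [ModObj (Torus k n) X] {p : X ⟶ S} (hp : IsInvariant n p)

theorem mul_mem_weightSheaf {χ ψ : Character n} {U : S.left.Opens} {f g : DirectImage p U}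
    (hf : f ∈ weightSheaf hp χ U) (hg : g ∈ weightSheaf hp ψ U) :
    f * g ∈ weightSheaf hp (χ + ψ) U :=
  mul_mem_weightSpace (isStable_preimage hp U) hf hg

theorem pow_mem_weightSheaf {χ : Character n} {U : S.left.Opens} {f : DirectImage p U}
    (hf : f ∈ weightSheaf hp χ U) (d : ℕ) : f ^ d ∈ weightSheaf hp (d • χ) U :=
  pow_mem_weightSpace (isStable_preimage hp U) hf d

variable [IsAffineHom p.left] {U : S.left.Opens} (hU : IsAffineOpen U)

/-- The homogeneous components of the sections of `p_* 𝒪_X` over an affine open subset. -/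
def components : DirectImage p U →+ (Character n →₀ DirectImage p U) :=
  weightComponents (hU.preimage p.left) (isStable_preimage hp U)

theorem components_mem (f : DirectImage p U) (χ : Character n) :
    components hp hU f χ ∈ weightSheaf hp χ U :=
  weightComponents_mem (hU.preimage p.left) (isStable_preimage hp U) f χ

theorem sum_components (f : DirectImage p U) : ((components hp hU f).sum fun _ x ↦ x) = f :=
  sum_weightComponents (hU.preimage p.left) (isStable_preimage hp U) f

theorem components_of_mem {f : DirectImage p U} {χ : Character n} (hf : f ∈ weightSheaf hp χ U) :
    components hp hU f = .single χ f :=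
  weightComponents_of_mem (hU.preimage p.left) (isStable_preimage hp U) hf

theorem components_mul {f : DirectImage p U} {χ : Character n} (hf : f ∈ weightSheaf hp χ U)
    (g : DirectImage p U) (ψ : Character n) :
    components hp hU (f * g) (χ + ψ) = f * components hp hU g ψ :=
  weightComponents_mul (hU.preimage p.left) (isStable_preimage hp U) hf ψ

theorem components_smul (c : Γ(S.left, U)) (g : DirectImage p U) (ψ : Character n) :
    components hp hU (c • g) ψ = c • components hp hU g ψ := by
  have := components_mul hp hU (algebraMap_mem_weightSheaf hp U c) g ψ
  rwa [zero_add, ← Algebra.smul_def, ← Algebra.smul_def] at this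

end Components

/-! ### Monomials that do not vanish on a fiber -/

section Monomials

variable {𝕏 X S : Over (Spec (.of k))} [ModObj (Torus k n) 𝕏] [ModObj (Torus k n) X]
  {p : X ⟶ S} {q : X ⟶ 𝕏} (hp : IsInvariant n p) (hq : IsModHom (Torus k n) q)
  {J : Type*} [Fintype J] {f : J → Γ(𝕏.left, ⊤)} {w : J → Character n}

include hq in
/-- If a component of a polynomial in the functions from `S` and `𝕏` does not vanish on a geometric
fiber, then neither does some monomial of the same weight in the given generators. -/
theorem exists_monomial_of_mem_closure [IsAffineHom p.left] (hf : ∀ i, f i ∈ weightSpace 𝕏 (w i) ⊤)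
    (hgen : Algebra.adjoin k (Set.range f) = ⊤) {U : S.left.Opens} (hU : IsAffineOpen U)
    {s : S.left} (hs : s ∈ U) {c : DirectImage p U}
    (hc : c ∈ Subring.closure (Set.range (algebraMap Γ(S.left, U) (DirectImage p U)) ∪
      Set.range (ofTarget p q U)))
    {ψ : Character n} (hψ : eval p hs (components hp hU c ψ) ≠ 0) :
    ∃ a : J → ℕ, monomialWeight w a = ψ ∧ eval p hs (ofTarget p q U (monomial f a)) ≠ 0 := by
  let A := Algebra.adjoin Γ(S.left, U) (Set.range fun i ↦ ofTarget p q U (f i))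
  have hA : Subring.closure (Set.range (algebraMap Γ(S.left, U) (DirectImage p U)) ∪
      Set.range (ofTarget p q U)) ≤ A.toSubring := by
    rw [Subring.closure_le]
    rintro _ (⟨r, rfl⟩ | ⟨g, rfl⟩)
    · exact A.algebraMap_mem r
    · have hg : g ∈ Algebra.adjoin k (Set.range f) := hgen ▸ Algebra.mem_top
      change ofTarget p q U g ∈ A
      induction hg using Algebra.adjoin_induction with
      | mem g hg =>
        obtain ⟨i, rfl⟩ := hg
        exact Algebra.subset_adjoin ⟨i, rfl⟩
      | algebraMap r =>
        rw [ofTarget_algebraMap]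
        exact A.algebraMap_mem _
      | add g h _ _ hg hh => rw [map_add]; exact add_mem hg hh
      | mul g h _ _ hg hh => rw [map_mul]; exact mul_mem hg hh
  have hcA : c ∈ Subalgebra.toSubmodule A := hA hc
  -- The section `c` is now a combination of monomials over the functions on `U`, and components are
  -- linear over these.
  rw [Algebra.adjoin_eq_span] at hcA
  clear hc
  induction hcA using Submodule.span_induction with
  | mem c hc =>
    obtain ⟨a, rfl⟩ := Submonoid.exists_of_mem_closure_range _ _ hc
    have hm : ∏ i, ofTarget p q U (f i) ^ a i = ofTarget p q U (monomial f a) := by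
      simp [monomial, map_prod]
    rw [hm, components_of_mem hp hU (ofTarget_mem_weightSheaf hp hq
      (monomial_mem_weightSpace isStable_top hf a) U)] at hψ
    by_cases h : monomialWeight w a = ψ
    · rw [h, Finsupp.single_eq_same] at hψ
      exact ⟨a, h, hψ⟩
    · rw [Finsupp.single_eq_of_ne (Ne.symm h), map_zero] at hψ
      exact absurd rfl hψ
  | zero => simp at hψ
  | add x y _ _ hx hy =>
    by_cases h : eval p hs (components hp hU x ψ) = 0
    · refine hy fun h' ↦ hψ ?_
      rw [map_add, Finsupp.add_apply, map_add, h, h', add_zero]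
    · exact hx h
  | smul r x _ hx =>
    refine hx fun h ↦ hψ ?_
    rw [components_smul, Algebra.smul_def, map_mul, h, mul_zero]

include hq in
/-- If a semiinvariant does not vanish on a geometric fiber, then neither does some monomial in the
given generators of weight a positive multiple of its weight. -/
theorem exists_monomial_of_eval_ne_zero [IsAffine 𝕏.left] [IsAffineHom p.left]
    [IsFinite (lift p q).left] (hf : ∀ i, f i ∈ weightSpace 𝕏 (w i) ⊤)
    (hgen : Algebra.adjoin k (Set.range f) = ⊤) {U : S.left.Opens} (hU : IsAffineOpen U)
    {s : S.left} [IsReduced (FiberSections p s)] (hs : s ∈ U) {χ : Character n} {x : DirectImage p U}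
    (hx : x ∈ weightSheaf hp χ U) (hxs : eval p hs x ≠ 0) :
    ∃ (d : ℕ) (a : J → ℕ), 0 < d ∧ monomialWeight w a = d • χ ∧
      eval p hs (ofTarget p q U (monomial f a)) ≠ 0 := by
  obtain ⟨m, c, hc, h⟩ := exists_integral_equation (p := p) (q := q) hU x
  have hpow : eval p hs (x ^ m) ≠ 0 := by
    rw [map_pow]
    exact pow_ne_zero m hxs
  -- The component of weight `m • χ` of the integral equation.
  have hcomp : x ^ m + ∑ j ∈ Finset.range m, x ^ j * components hp hU (c j) ((m - j) • χ) = 0 := by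
    have := congr($(congrArg (components hp hU) h) (m • χ))
    rw [map_add, map_zero, map_sum, Finsupp.add_apply, Finsupp.finsetSum_apply,
      components_of_mem hp hU (pow_mem_weightSheaf hp hx m), Finsupp.single_eq_same] at this
    rw [← Finsupp.zero_apply (a := m • χ), ← this]
    congr 1
    refine Finset.sum_congr rfl fun j hj ↦ ?_
    rw [← components_mul hp hU (pow_mem_weightSheaf hp hx j), ← add_smul,
      Nat.add_sub_cancel' (Finset.mem_range.mp hj).le, mul_comm]
  obtain ⟨j, hj, hjs⟩ : ∃ j ∈ Finset.range m,
      eval p hs (components hp hU (c j) ((m - j) • χ)) ≠ 0 := by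
    by_contra! h0
    apply hpow
    have := congrArg (eval p hs) hcomp
    rw [map_add, map_zero, map_sum, Finset.sum_eq_zero fun j hj ↦ by rw [map_mul, h0 j hj, mul_zero],
      add_zero] at this
    exact this
  obtain ⟨a, ha, has⟩ := exists_monomial_of_mem_closure hp hq hf hgen hU hs (hc j) hjs
  exact ⟨m - j, a, Nat.sub_pos_of_lt (Finset.mem_range.mp hj), ha, has⟩

end Monomials

end DirectImage

/-! ### Weights of monomials -/

section Combinatorics

variable {J : Type*} [Fintype J] (w : J → Character n)

/-- The characters whose coordinates are bounded by the sums of those of the weights `w`. -/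
def boundedCharacters : Set (Character n) := {χ | ∀ j, |χ j| ≤ ∑ i, |w i j|}

theorem finite_boundedCharacters : (boundedCharacters w).Finite :=
  (Set.finite_Icc (fun j ↦ -∑ i, |w i j|) fun j ↦ ∑ i, |w i j|).subset fun _ hχ ↦
    ⟨fun j ↦ (abs_le.mp (hχ j)).1, fun j ↦ (abs_le.mp (hχ j)).2⟩

theorem mem_boundedCharacters (i : J) : w i ∈ boundedCharacters w := fun j ↦
  Finset.single_le_sum (f := fun i ↦ |w i j|) (fun _ _ ↦ abs_nonneg _) (Finset.mem_univ i)

variable {w}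

/-- Division with remainder in the saturation of the monoid that is generated by `w`. -/
theorem exists_eq_monomialWeight_add {d : ℕ} (hd : 0 < d) {a : J → ℕ} {χ : Character n}
    (h : monomialWeight w a = d • χ) :
    ∃ χ' ∈ boundedCharacters w, χ = monomialWeight w (fun i ↦ a i / d) + χ' ∧
      monomialWeight w (fun i ↦ a i % d) = d • χ' := by
  have ha : a = (fun i ↦ a i % d) + d • fun i ↦ a i / d := by
    ext i
    simp [Nat.mod_add_div]
  have hw : monomialWeight w (fun i ↦ a i % d) =
      d • (χ - monomialWeight w fun i ↦ a i / d) := by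
    rw [smul_sub, ← h, eq_sub_iff_add_eq, ← monomialWeight_smul, ← monomialWeight_add, ← ha]
  refine ⟨χ - monomialWeight w (fun i ↦ a i / d), fun j ↦ ?_, by abel, hw⟩
  generalize χ - monomialWeight w (fun i ↦ a i / d) = χ' at hw
  -- All remainders are less than `d`, so dividing by `d` gives a bound independent of `a` and `d`.
  have hj : (d : ℤ) * χ' j = ∑ i, ((a i % d : ℕ) : ℤ) * w i j := by
    have := (congrFun hw j).symm
    simpa [monomialWeight] using this
  have hd' : (0 : ℤ) < d := by exact_mod_cast hd
  refine le_of_mul_le_mul_left ?_ hd'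
  calc (d : ℤ) * |χ' j| = |∑ i, ((a i % d : ℕ) : ℤ) * w i j| := by
        rw [← hj, abs_mul, abs_of_pos hd']
    _ ≤ ∑ i, |((a i % d : ℕ) : ℤ) * w i j| := Finset.abs_sum_le_sum_abs _ _
    _ ≤ ∑ i, (d : ℤ) * |w i j| := Finset.sum_le_sum fun i _ ↦ by
        rw [abs_mul, Nat.abs_cast]
        gcongr
        exact (Nat.mod_lt _ hd).le
    _ = d * ∑ i, |w i j| := (Finset.mul_sum _ _ _).symm

variable (w) in
/-- The exponents of the saturations of the monoids generated by subfamilies of `w` are bounded. -/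
theorem exists_uniform_exponent : ∃ N : ℕ, 0 < N ∧ ∀ (d : ℕ) (a : J → ℕ) (χ : Character n), 0 < d →
    monomialWeight w a = d • χ →
      ∃ b : J → ℕ, (∀ i, a i = 0 → b i = 0) ∧ monomialWeight w b = N • χ := by
  classical
  -- For a fixed support and character, any one admissible `d` serves as `M`; if there is none, the
  -- claim is vacuous and `M = 1`.
  have key (x : Finset J × Character n) : ∃ M : ℕ, 0 < M ∧ ∀ (d : ℕ) (a : J → ℕ), 0 < d →
      (∀ i ∉ x.1, a i = 0) → monomialWeight w a = d • x.2 →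
        ∃ b : J → ℕ, (∀ i ∉ x.1, b i = 0) ∧ monomialWeight w b = M • x.2 := by
    by_cases h : ∃ (d : ℕ) (a : J → ℕ), 0 < d ∧ (∀ i ∉ x.1, a i = 0) ∧ monomialWeight w a = d • x.2
    · obtain ⟨d, a, hd, ha, hw⟩ := h
      exact ⟨d, hd, fun _ _ _ _ _ ↦ ⟨a, ha, hw⟩⟩
    · exact ⟨1, one_pos, fun d a hd ha hw ↦ absurd ⟨d, a, hd, ha, hw⟩ h⟩
  choose M hM hMw using key
  let P : Finset (Finset J × Character n) := Finset.univ ×ˢ (finite_boundedCharacters w).toFinset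
  refine ⟨∏ x ∈ P, M x, Finset.prod_pos fun x _ ↦ hM x, fun d a χ hd h ↦ ?_⟩
  obtain ⟨χ', hχ', hχ, hr⟩ := exists_eq_monomialWeight_add hd h
  let x : Finset J × Character n := (Finset.univ.filter fun i ↦ a i ≠ 0, χ')
  have hx : x ∈ P := by simp [P, x, hχ']
  obtain ⟨L, hL⟩ := Finset.dvd_prod_of_mem M hx
  have hmem (i : J) : i ∉ x.1 ↔ a i = 0 := by simp [x]
  obtain ⟨c, hc, hcw⟩ := hMw x d (fun i ↦ a i % d) hd
    (fun i hi ↦ by rw [(hmem i).mp hi, Nat.zero_mod]) hr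
  -- With `N = M x * L`, the quotient is scaled by `N`, and the solution `c` for `M x • χ'` by `L`.
  refine ⟨(∏ x ∈ P, M x) • (fun i ↦ a i / d) + L • c, fun i hi ↦ ?_, ?_⟩
  · simp [hi, hc i ((hmem i).mpr hi)]
  · rw [monomialWeight_add, monomialWeight_smul, monomialWeight_smul, hcw, hχ, smul_add,
      add_right_inj, smul_smul, hL, mul_comm]

end Combinatorics

namespace DirectImage

variable {𝕏 X S : Over (Spec (.of k))} [ModObj (Torus k n) 𝕏] [ModObj (Torus k n) X]
  {p : X ⟶ S} {q : X ⟶ 𝕏} {J : Type*} [Fintype J] {f : J → Γ(𝕏.left, ⊤)} {w : J → Character n}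

/-- The monomial with exponents `b` divides a power of the one with exponents `a`, and this power is
nonzero on the reduced fiber. -/
theorem eval_monomial_ne_zero {U : S.left.Opens} {s : S.left} [IsReduced (FiberSections p s)]
    (hs : s ∈ U) {a b : J → ℕ} (hab : ∀ i, a i = 0 → b i = 0)
    (ha : eval p hs (ofTarget p q U (monomial f a)) ≠ 0) :
    eval p hs (ofTarget p q U (monomial f b)) ≠ 0 := by
  let L := ∑ i, b i
  have hb (i : J) : b i ≤ L * a i := by
    rcases Nat.eq_zero_or_pos (a i) with h | h
    · rw [hab i h]; exact Nat.zero_le _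
    · exact (Finset.single_le_sum (f := b) (fun _ _ ↦ Nat.zero_le _) (Finset.mem_univ i)).trans
        (Nat.le_mul_of_pos_right _ h)
  have hL : L • a = b + fun i ↦ L * a i - b i := by
    ext i
    simp [Nat.add_sub_cancel' (hb i)]
  intro h
  apply pow_ne_zero L ha
  rw [← map_pow, ← map_pow, ← monomial_smul, hL, monomial_add, map_mul, map_mul, h, zero_mul]

end DirectImage

theorem hilbertFunction_le_one (A : Set (Character n)) (χ : Character n) :
    hilbertFunction A χ ≤ 1 := by
  unfold hilbertFunction
  split_ifs <;> simp

/-! ### Local generators of the weight sheaves of a family -/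

namespace IsStableToricFamily

open DirectImage

variable {𝕏 X S : Over (Spec (.of k))} [ModObj (Torus k n) 𝕏] [ModObj (Torus k n) X]
  {p : X ⟶ S} {q : X ⟶ 𝕏} (hX : IsStableToricFamily n p q)
  {J : Type*} [Fintype J] {f : J → Γ(𝕏.left, ⊤)} {w : J → Character n}

include hX

theorem isReduced_fiberSections (s : S.left) : IsReduced (FiberSections p s) :=
  have := hX.reduced _ (geometricPoint S.left s)
  inferInstance

theorem exists_eval_ne_zero {χ : Character n} (hχ : χ ∈ saturatedWeightSet (n := n) 𝕏) {s : S.left}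
    {U : S.left.Opens} (hs : s ∈ U) :
    ∃ (V : S.left.Opens) (_ : V ≤ U) (hsV : s ∈ V), IsAffineOpen V ∧
      ∃ x ∈ weightSheaf hX.invariant χ V, eval p hsV x ≠ 0 := by
  have := hX.affine
  have hl := hX.locallyFree χ
  rw [hilbertFunction, if_pos hχ] at hl
  obtain ⟨U', hsU', e, he⟩ := hl s
  obtain ⟨V, hV, hsV, hVU⟩ := exists_isAffineOpen_mem_and_subset
    (show s ∈ U ⊓ U' from ⟨hs, hsU'⟩)
  have hVU : V ≤ U ⊓ U' := hVU
  obtain ⟨b, -⟩ := he V (hVU.trans inf_le_right)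
  exact ⟨V, hVU.trans inf_le_left, hsV, hV, b 0, (b 0).2, eval_basis_ne_zero _ hV hsV b⟩

/-- The integrality argument is applied to a local basis near `s`; the resulting monomial comes from
`𝕏`, so it is already defined over `U`. -/
theorem exists_monomial [IsAffine 𝕏.left] (hf : ∀ i, f i ∈ weightSpace 𝕏 (w i) ⊤)
    (hgen : Algebra.adjoin k (Set.range f) = ⊤) {χ : Character n}
    (hχ : χ ∈ saturatedWeightSet (n := n) 𝕏) {s : S.left} {U : S.left.Opens} (hs : s ∈ U) :
    ∃ (d : ℕ) (a : J → ℕ), 0 < d ∧ monomialWeight w a = d • χ ∧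
      eval p hs (ofTarget p q U (monomial f a)) ≠ 0 := by
  have := hX.affine
  have := hX.finite
  have := hX.isReduced_fiberSections s
  obtain ⟨V, hVU, hsV, hV, x, hx, hxs⟩ := hX.exists_eval_ne_zero hχ hs
  obtain ⟨d, a, hd, hw, ha⟩ :=
    exists_monomial_of_eval_ne_zero hX.invariant hX.equivariant hf hgen hV hsV hx hxs
  refine ⟨d, a, hd, hw, ?_⟩
  rwa [← res_ofTarget p q hVU, eval_res] at ha

theorem exists_generates {χ : Character n} {s : S.left} {U : S.left.Opens} (hs : s ∈ U)
    {g : DirectImage p U} (hg : g ∈ weightSheaf hX.invariant χ U) (hgs : eval p hs g ≠ 0) :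
    ∃ (V : S.left.Opens) (hVU : V ≤ U), s ∈ V ∧ ∀ (W : S.left.Opens) (hW : W ≤ V),
      ∀ h ∈ weightSheaf hX.invariant χ W, ∃ c : Γ(S.left, W), h = c • res p (hW.trans hVU) g :=
  exists_generates_of_eval_ne_zero hX.invariant (hilbertFunction_le_one _ χ) (hX.locallyFree χ)
    hs hg hgs

/-- Near every point, a semiinvariant of weight `χ` that does not vanish on the geometric fiber is
the product of a monomial in the generators and a semiinvariant of bounded weight. -/
theorem exists_generator [IsAffine 𝕏.left] [IsDomain Γ(𝕏.left, ⊤)]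
    (hf : ∀ i, f i ∈ weightSpace 𝕏 (w i) ⊤) (hf₀ : ∀ i, f i ≠ 0)
    (hgen : Algebra.adjoin k (Set.range f) = ⊤) {χ : Character n}
    (hχ : χ ∈ saturatedWeightSet (n := n) 𝕏) {s : S.left} {U : S.left.Opens} (hs : s ∈ U) :
    ∃ (V : S.left.Opens) (_ : V ≤ U) (hsV : s ∈ V),
      ∃ χ' ∈ boundedCharacters w ∩ saturatedWeightSet (n := n) 𝕏,
        ∃ x ∈ weightSheaf hX.invariant χ' V, ∃ b : J → ℕ, χ = monomialWeight w b + χ' ∧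
          eval p hsV (ofTarget p q V (monomial f b) * x) ≠ 0 := by
  obtain ⟨d, a, hd, hw, ha⟩ := hX.exists_monomial hf hgen hχ hs
  obtain ⟨χ', hχ', hχ, hr⟩ := exists_eq_monomialWeight_add hd hw
  have hmem (c : J → ℕ) := monomial_mem_weightSpace isStable_top hf c
  -- The remainder monomial has weight `d • χ'` and is nonzero because `k[𝕏]` is a domain.
  have hχ'sat : χ' ∈ saturatedWeightSet (n := n) 𝕏 := by
    refine ⟨d, hd, fun h ↦ ?_⟩
    have := hmem fun i ↦ a i % d
    rw [hr, h, Submodule.mem_bot] at this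
    exact Finset.prod_ne_zero_iff.mpr (fun i _ ↦ pow_ne_zero _ (hf₀ i)) this
  obtain ⟨V, hVU, hsV, -, x, hx, hxs⟩ := hX.exists_eval_ne_zero hχ'sat hs
  refine ⟨V, hVU, hsV, χ', ⟨hχ', hχ'sat⟩, x, hx, fun i ↦ a i / d, hχ, fun h ↦ ?_⟩
  have := hX.isReduced_fiberSections s
  have hxd : eval p hsV (x ^ d) ≠ 0 := by
    rw [map_pow]
    exact pow_ne_zero d hxs
  obtain ⟨W, hWV, hsW, hW⟩ := hX.exists_generates hsV (pow_mem_weightSheaf _ hx d) hxd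
  obtain ⟨c, hc⟩ := hW W le_rfl _ (ofTarget_mem_weightSheaf hX.invariant hX.equivariant
    (hr ▸ hmem fun i ↦ a i % d) W)
  have haW : eval p hsW (ofTarget p q W (monomial f a)) ≠ 0 := by
    rwa [← res_ofTarget p q (hWV.trans hVU), eval_res]
  have had : a = (fun i ↦ a i % d) + d • fun i ↦ a i / d := by
    ext i
    simp [Nat.mod_add_div]
  apply haW
  -- On the fiber, the monomial `f ^ a` is `c` times the `d`-th power of the product assumed to
  -- vanish.
  rw [had, monomial_add, map_mul, hc, monomial_smul, Algebra.smul_def, ← res_ofTarget p q hWV,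
    map_pow, map_pow, map_mul, map_mul, map_pow, eval_res, map_pow, map_pow, eval_res,
    mul_assoc, ← mul_pow,
    mul_comm (eval p _ x), ← map_mul, h, zero_pow hd.ne', mul_zero]

/-- The comparison map is surjective in the weights that are multiples of a uniform exponent. -/
theorem isComparisonSurjective [IsAffine 𝕏.left]
    (hf : ∀ i, f i ∈ weightSpace 𝕏 (w i) ⊤) (hgen : Algebra.adjoin k (Set.range f) = ⊤) {N : ℕ}
    (hN : ∀ (d : ℕ) (a : J → ℕ) (χ : Character n), 0 < d → monomialWeight w a = d • χ →
      ∃ b : J → ℕ, (∀ i, a i = 0 → b i = 0) ∧ monomialWeight w b = N • χ)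
    {χ : Character n} (hχ : χ ∈ saturatedWeightSet (n := n) 𝕏) :
    IsComparisonSurjective hX.invariant hX.equivariant (N • χ) := by
  intro U h s hs
  have := hX.isReduced_fiberSections s
  obtain ⟨d, a, hd, hw, ha⟩ := hX.exists_monomial hf hgen hχ hs
  obtain ⟨b, hab, hb⟩ := hN d a χ hd hw
  have hbs := eval_monomial_ne_zero hs hab ha
  have hmem : monomial f b ∈ weightSpace 𝕏 (N • χ) ⊤ :=
    hb ▸ monomial_mem_weightSpace isStable_top hf b
  obtain ⟨V, hVU, hsV, hV⟩ := hX.exists_generates hs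
    (ofTarget_mem_weightSheaf hX.invariant hX.equivariant hmem U) hbs
  obtain ⟨c, hc⟩ := hV V le_rfl _ (res_mem_weightSheaf hX.invariant hVU h.2)
  refine ⟨V, hVU, hsV, c ⊗ₜ ⟨monomial f b, hmem⟩, ?_⟩
  rw [hc, res_ofTarget, comparison, LinearMap.liftBaseChange_tmul]
  rfl

/-- The direct image is generated by its semiinvariants of bounded weights. -/
theorem isGeneratedByWeights [IsAffine 𝕏.left] [IsDomain Γ(𝕏.left, ⊤)]
    (hf : ∀ i, f i ∈ weightSpace 𝕏 (w i) ⊤) (hf₀ : ∀ i, f i ≠ 0)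
    (hgen : Algebra.adjoin k (Set.range f) = ⊤) :
    IsGeneratedByWeights hX.invariant (boundedCharacters w ∩ saturatedWeightSet (n := n) 𝕏) := by
  intro U₀ g₀ s hs₀
  let B := boundedCharacters w ∩ saturatedWeightSet (n := n) 𝕏
  let A (W : S.left.Opens) : Subalgebra Γ(S.left, W) (DirectImage p W) :=
    Algebra.adjoin _ (⋃ χ ∈ B, (weightSheaf hX.invariant χ W : Set (DirectImage p W)))
  have hA (W : S.left.Opens) {χ : Character n} (hχ : χ ∈ B) {x : DirectImage p W}
      (hx : x ∈ weightSheaf hX.invariant χ W) : x ∈ A W :=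
    Algebra.subset_adjoin (Set.mem_biUnion hχ hx)
  have hwB (i : J) : w i ∈ B :=
    ⟨mem_boundedCharacters w i, 1, one_pos, fun h ↦ hf₀ i <| by
      rw [one_smul] at h
      simpa [h] using hf i⟩
  obtain ⟨U, hU, hs, hUU₀⟩ := exists_isAffineOpen_mem_and_subset hs₀
  have hUU₀ : U ≤ U₀ := hUU₀
  -- Asking for all `W ≤ V` lets the neighbourhoods for the finitely many components of `g` be
  -- intersected.
  suffices H : ∀ g : DirectImage p U, ∃ (V : S.left.Opens) (hVU : V ≤ U), s ∈ V ∧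
      ∀ (W : S.left.Opens) (hW : W ≤ V), res p (hW.trans hVU) g ∈ A W by
    obtain ⟨V, hVU, hsV, hV⟩ := H (res p hUU₀ g₀)
    refine ⟨V, hVU.trans hUU₀, hsV, ?_⟩
    have := hV V le_rfl
    rwa [res_res] at this
  have := hX.affine
  intro g
  rw [← sum_components hX.invariant hU g, Finsupp.sum]
  refine Finset.sum_induction _ (fun g ↦ ∃ (V : S.left.Opens) (hVU : V ≤ U), s ∈ V ∧
      ∀ (W : S.left.Opens) (hW : W ≤ V), res p (hW.trans hVU) g ∈ A W) ?_ ?_ ?_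
  · rintro x y ⟨V₁, hV₁, hs₁, h₁⟩ ⟨V₂, hV₂, hs₂, h₂⟩
    refine ⟨V₁ ⊓ V₂, inf_le_left.trans hV₁, ⟨hs₁, hs₂⟩, fun W hW ↦ ?_⟩
    rw [map_add]
    exact add_mem (h₁ W (hW.trans inf_le_left)) (h₂ W (hW.trans inf_le_right))
  · exact ⟨U, le_rfl, hs, fun W hW ↦ by rw [map_zero]; exact zero_mem _⟩
  · intro χ _
    have hg := components_mem hX.invariant hU g χ
    by_cases hχ : χ ∈ saturatedWeightSet (n := n) 𝕏
    · obtain ⟨V₁, hV₁, hs₁, χ', hχ', x, hx, b, hb, hbx⟩ := hX.exists_generator hf hf₀ hgen hχ hs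
      have hmem := monomial_mem_weightSpace isStable_top hf b
      obtain ⟨V, hV, hsV, hVg⟩ := hX.exists_generates hs₁ (hb ▸ mul_mem_weightSheaf hX.invariant
        (ofTarget_mem_weightSheaf hX.invariant hX.equivariant hmem V₁) hx) hbx
      refine ⟨V, hV.trans hV₁, hsV, fun W hW ↦ ?_⟩
      obtain ⟨c, hc⟩ := hVg W hW _ (res_mem_weightSheaf hX.invariant
        (hW.trans (hV.trans hV₁)) hg)
      rw [hc, map_mul, res_ofTarget, monomial, map_prod]
      refine (A W).smul_mem ((A W).mul_mem ((A W).prod_mem fun i _ ↦ ?_) ?_) c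
      · rw [map_pow]
        exact (A W).pow_mem (hA W (hwB i)
          (ofTarget_mem_weightSheaf hX.invariant hX.equivariant (hf i) W)) _
      · exact hA W hχ' (res_mem_weightSheaf hX.invariant _ hx)
    -- Outside the saturated weight set the rank is zero, so the component vanishes near `s`.
    · have hl := hX.locallyFree χ
      rw [hilbertFunction, if_neg hχ] at hl
      obtain ⟨V, hsV, e, he⟩ := hl s
      refine ⟨U ⊓ V, inf_le_left, ⟨hs, hsV⟩, fun W hW ↦ ?_⟩
      obtain ⟨b, -⟩ := he W (hW.trans inf_le_right)
      have h₀ : (⟨_, res_mem_weightSheaf hX.invariant (hW.trans inf_le_left) hg⟩ :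
          weightSheaf hX.invariant χ W) = 0 := b.ext_elem fun i ↦ i.elim0
      have h₁ := congrArg Subtype.val h₀
      rw [Submodule.coe_zero] at h₁
      change res p _ _ = 0 at h₁
      rw [h₁]
      exact zero_mem _

end IsStableToricFamily

end ToricFamilies

end

/-- `𝕏` is an irreducible affine `T`-variety over an algebraically closed field `k` of
characteristic zero, for `T = (kˣ)ⁿ`. -/
theorem lemma3p3 {k : Type*} [Field k] [IsAlgClosed k] [CharZero k] (n : ℕ)
    (𝕏 : Over (Spec (.of k))) [ModObj (ToricFamilies.Torus k n) 𝕏]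
    [IsAffine 𝕏.left] [IsIntegral 𝕏.left] [LocallyOfFiniteType 𝕏.hom] :
    (∃ A : Finset (ToricFamilies.Character n), ↑A ⊆ ToricFamilies.saturatedWeightSet (n := n) 𝕏 ∧
      ∀ (S X : Over (Spec (.of k))) [ModObj (ToricFamilies.Torus k n) X] (p : X ⟶ S) (q : X ⟶ 𝕏)
        (hX : ToricFamilies.IsStableToricFamily n p q),
        ToricFamilies.IsGeneratedByWeights hX.invariant ↑A) ∧
    (∃ N : ℕ, 0 < N ∧
      ∀ (S X : Over (Spec (.of k))) [ModObj (ToricFamilies.Torus k n) X] (p : X ⟶ S) (q : X ⟶ 𝕏)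
        (hX : ToricFamilies.IsStableToricFamily n p q),
        ∀ χ ∈ ToricFamilies.saturatedWeightSet (n := n) 𝕏,
          ToricFamilies.IsComparisonSurjective hX.invariant hX.equivariant (N • χ)) := by
  have : IsDomain Γ(𝕏.left, ⊤) := inferInstance
  obtain ⟨m, f, w, hf, hf₀, hgen⟩ := ToricFamilies.exists_homogeneous_generators (n := n) 𝕏
  obtain ⟨N, hN₀, hN⟩ := ToricFamilies.exists_uniform_exponent w
  have hfin := (ToricFamilies.finite_boundedCharacters w).inter_of_left
    (ToricFamilies.saturatedWeightSet (n := n) 𝕏)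
  refine ⟨⟨hfin.toFinset, ?_, fun S X _ p q hX ↦ ?_⟩, N, hN₀, fun S X _ p q hX χ hχ ↦
    hX.isComparisonSurjective hf hgen hN hχ⟩
  · rw [hfin.coe_toFinset]
    exact Set.inter_subset_right
  · rw [hfin.coe_toFinset]
    exact hX.isGeneratedByWeights hf hf₀ hgen
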